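/- Let $L^\infty(S^1)$ be the space of bounded complex-valued functions on the circle $S^1=\mathbb R/2\pi\mathbb Z$, and let $X$ be the space of sequences $a=(a_1,a_2,\dots)$ in $L^\infty(S^1)$ such that, for some $l>0$ depending on $a$, $\sup|a_i|\le l^i$ for all $i\ge 1$. For $a\in X$ and $i_1,\dots,i_k\ge 1$ put $$I_{i_1,\dots,i_k}(a)=\int\cdots\int_{0\le s_1\le\cdots\le s_k\le 2\pi}a_{i_k}(s_k)\cdots a_{i_1}(s_1)\,ds_k\cdots ds_1$$ (equal to $1$ for $k=0$); these are the basic iterated integrals. For sequences $a,b$ of functions define, componentwise, $$(a*b)_i(t)=\begin{cases}2a_i(2t),&0<t\le\pi,\\2b_i(2t-2\pi),&\pi<t\le 2\pi,\end{cases}\qquad (a^{-1})_i(t)=-a_i(2\pi-t),\quad 0<t\le 2\pi.$$ For $a,b\in X$ write $a\sim b$ if $I_{i_1,\dots,i_k}(a*b^{-1})=0$ for all $k\ge1$ and all $i_1,\dots,i_k\ge 1$. This is an equivalence relation; let $G(X)$ be the set of its classes and $[a]$ the class of $a$. Say that $a\in X$ determines a center if for all sufficiently small $r\in\mathbb C$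 the Lipschitz solution $v$ on $[0,2\pi]$ of $v'=\sum_{i\ge1}a_i(x)v^{i+1}$ (for almost every $x$) with $v(0)=r$ satisfies $v(2\pi)=v(0)$. Let $\widehat{\mathcal C}\subset G(X)$ be the set of classes $[a]$ of those $a\in X$ that determine a center; equivalently, the kernel of the homomorphism that sends $[a]$ to the germ of the first return map $r\mapsto v(2\pi)$. Let $F\subseteq F'$ be subfields of $\mathbb C$, and let $b=(b_k)_{k\ge1}$ be a sequence in $L^\infty(S^1)$ with $\sup|b_k|\le1$ for all $k$. Let $\hat b\in X$ be the sequence of all non-constant monomials $b_{i_1}^{\alpha_1}\cdots b_{i_n}^{\alpha_n}$, arranged in some order, and suppose that $[\hat b]$ is defined over $F$, that is, all basic iterated integrals of $\hat b$ belong to $F$. Let $\mathcal A_{F'}(b)$ be the set of all $F'$-linear combinations of these monomials. Let $P:[0,1]\to X$ be an $X_{F'}(b)$-polynomial map, that is, $$P(t)=c_1^{\epsilon_1}(t)*\cdots*c_k^{\epsilon_k}(t)\in X,\qquad t\in[0,1],$$ for some $k\ge1$, some bracketing of the product, and some $\epsilon_i\in\{1,-1\}$, where each $c_i(t)=(c_{1i}(t),c_{2i}(t),\dots)$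 is a sequence of polynomials $c_{ji}(t)$ in $t$ with coefficients in $\mathcal A_{F'}(b)$. Put $[P](t)=[P(t)]$. If $[P](0)\notin\widehat{\mathcal C}$ and $[P](\xi)\in\widehat{\mathcal C}$ for some $\xi\in(0,1]$, then $\xi$ is algebraic over $F'$. -/

import Mathlib

open MeasureTheory Set
open scoped Real

namespace CenterProblem

instance factTwoPiPos : Fact (0 < 2 * π) := ⟨Real.two_pi_pos⟩

/-- The unit circle `S¹ = ℝ / 2πℤ`, with Lebesgue measure of total mass `2π`. -/
abbrev Circ : Type := AddCircle (2 * π)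

/-- Sequences `(a₁, a₂, …)` of complex functions on the circle.  The entry with index `i : ℕ` is the
coefficient `a_{i+1}`. -/
abbrev CoeffSeq : Type := ℕ → Circ → ℂ

/-- Membership in the space `X`: every `aᵢ` is (a representative of) an element of `L^∞(S¹)`, and
`sup |aᵢ| ≤ lⁱ` for all `i ≥ 1`, for some positive `l` depending on `a`. -/
def MemX (a : CoeffSeq) : Prop :=
  (∀ i, AEStronglyMeasurable (a i) (volume : Measure Circ)) ∧
    ∃ l : ℝ, 0 < l ∧ ∀ i, ∀ᵐ x ∂(volume : Measure Circ), ‖a i x‖ ≤ l ^ (i + 1)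

/-- The space `X` of coefficients of the equations `v' = ∑_{i ≥ 1} aᵢ(x) v^{i+1}`. -/
def X : Type := {a : CoeffSeq // MemX a}

/-- The product `*`: `(a * b)(t) = 2 a(2t)` for `0 < t ≤ π` and `2 b(2t - 2π)` for `π < t ≤ 2π`. -/
noncomputable def starProd (a b : CoeffSeq) : CoeffSeq := fun i =>
  AddCircle.liftIoc (2 * π) 0 fun t : ℝ =>
    if t ≤ π then 2 * a i ((2 * t : ℝ) : Circ) else 2 * b i ((2 * t - 2 * π : ℝ) : Circ)

/-- The inverse: `a⁻¹(t) = - a(2π - t)` for `0 < t ≤ 2π`. -/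
noncomputable def inv (a : CoeffSeq) : CoeffSeq := fun i =>
  AddCircle.liftIoc (2 * π) 0 fun t : ℝ => - a i ((2 * π - t : ℝ) : Circ)

/-- `nestedIntegral a [i_k, …, i_1] x` is
`∫⋯∫_{0 ≤ s₁ ≤ ⋯ ≤ s_k ≤ x} a_{i_k}(s_k) ⋯ a_{i_1}(s_1) ds_k ⋯ ds_1`; the head of the list
belongs to the outermost variable `s_k`. -/
noncomputable def nestedIntegral (a : CoeffSeq) : List ℕ → ℝ → ℂ
  | [], _ => 1
  | i :: w, x => ∫ s in (0 : ℝ)..x, a i (s : Circ) * nestedIntegral a w s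

/-- The basic iterated integrals on `X`. -/
noncomputable def iteratedIntegral (w : List ℕ) (a : CoeffSeq) : ℂ :=
  nestedIntegral a w (2 * π)

/-- Universal centers: all non-constant basic iterated integrals vanish. -/
def IsUniversalCenter (a : CoeffSeq) : Prop :=
  ∀ w : List ℕ, w ≠ [] → iteratedIntegral w a = 0

/-- The relation `a ∼ b` on `X`: `a * b⁻¹` is a universal center. -/
def Equivalent (a b : X) : Prop := IsUniversalCenter (starProd a.1 (inv b.1))

/-- The set `G(X)` of equivalence classes of `∼`. -/
def G : Type := Quot Equivalent

/-- The class `[a]` of `a ∈ X`. -/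
def cls (a : X) : G := Quot.mk Equivalent a

/-- Lipschitz solutions on `[0, 2π]` of `v' = ∑_{i ≥ 1} aᵢ(x) v^{i+1}` (the equation, including
convergence of its right-hand side, is required for almost every `x`). -/
def IsSolution (a : CoeffSeq) (v : ℝ → ℂ) : Prop :=
  (∃ K, LipschitzOnWith K v (Icc 0 (2 * π))) ∧
    ∀ᵐ x : ℝ ∂(volume.restrict (Icc (0 : ℝ) (2 * π))), ∃ D : ℂ,
      HasSum (fun i : ℕ => a i (x : Circ) * v x ^ (i + 2)) D ∧ HasDerivAt v D x

/-- The equation determines a center: for all sufficiently small initial values `r` the solution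
with `v(0) = r` satisfies `v(2π) = v(0)`. -/
def IsCenter (a : CoeffSeq) : Prop :=
  ∃ ε : ℝ, 0 < ε ∧ ∀ r : ℂ, ‖r‖ < ε →
    ∃ v : ℝ → ℂ, IsSolution a v ∧ v 0 = r ∧ v (2 * π) = v 0

/-- The center set in `X`. -/
def centerSet : Set X := {a | IsCenter a.1}

/-- The image in `G(X)` of the center set.  This is the kernel of `[a] ↦ (r ↦ v(2π; r; a))`, the
homomorphism sending a class to the germ at `0` of the first return map. -/
def centerSubgroup : Set G := cls '' centerSet

/-- The (non-constant) monomial `∏ b_k ^ {m_k}` in the functions `b_k`. -/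
noncomputable def monomial (b : ℕ → Circ → ℂ) (m : {m : ℕ →₀ ℕ // m ≠ 0}) : Circ → ℂ :=
  fun x => m.1.prod fun k n => b k x ^ n

theorem memX_monomial (b : ℕ → Circ → ℂ)
    (hm : ∀ k, AEStronglyMeasurable (b k) (volume : Measure Circ))
    (hb : ∀ k, ∀ᵐ x ∂(volume : Measure Circ), ‖b k x‖ ≤ 1)
    (e : ℕ → {m : ℕ →₀ ℕ // m ≠ 0}) : MemX fun i => monomial b (e i) := by
  refine ⟨fun i => ?_, 1, one_pos, fun i => ?_⟩
  · unfold monomial Finsupp.prod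
    exact Finset.aestronglyMeasurable_fun_prod _ fun k _ => (hm k).pow _
  · filter_upwards [ae_all_iff.2 hb] with x hx
    simp only [monomial, Finsupp.prod, norm_prod, norm_pow, one_pow]
    exact Finset.prod_le_one (fun _ _ => by positivity)
      fun k _ => pow_le_one₀ (norm_nonneg _) (hx k)

/-- The element `b̂ ∈ X` whose components are all the monomials in the `b_k`, arranged in a sequence
according to the enumeration `e` of exponents. -/
noncomputable def hatb (b : ℕ → Circ → ℂ)
    (hm : ∀ k, AEStronglyMeasurable (b k) (volume : Measure Circ))
    (hb : ∀ k, ∀ᵐ x ∂(volume : Measure Circ), ‖b k x‖ ≤ 1)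
    (e : ℕ → {m : ℕ →₀ ℕ // m ≠ 0}) : X :=
  ⟨fun i => monomial b (e i), memX_monomial b hm hb e⟩

/-- `[a]` is defined over the field `F`: all basic iterated integrals of `a` (which depend only on
`[a]`) belong to `F`. -/
def ClassDefinedOver (F : Subfield ℂ) (a : X) : Prop :=
  ∀ w : List ℕ, iteratedIntegral w a.1 ∈ F

/-- The algebra over `F'` generated by `b`: the `F'`-linear combinations of monomials in the
`b_k`. -/
noncomputable def algebraGen (F' : Subfield ℂ) (b : ℕ → Circ → ℂ) : Submodule F' (Circ → ℂ) :=
  Submodule.span F' (range (monomial b))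

/-- `c(t) = (c₁(t), c₂(t), …)` where every `c_k(t)` is a polynomial in `t` with coefficients in the
algebra over `F'` generated by `b`. -/
def IsPolynomialSeq (F' : Subfield ℂ) (b : ℕ → Circ → ℂ) (c : ℝ → CoeffSeq) : Prop :=
  ∀ k, ∃ (d : ℕ) (f : ℕ → Circ → ℂ), (∀ j, f j ∈ algebraGen F' b) ∧
    ∀ t x, c t k x = ∑ j ∈ Finset.range (d + 1), (t : ℂ) ^ j * f j x

/-- The `*`-products `c₁^{ε₁}(t) * ⋯ * c_n^{ε_n}(t)` with `n ≥ 1`, `εᵢ = ±1`, every `cᵢ(t)`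
polynomial in `t`, and any placement of the brackets. -/
inductive IsStarProduct (F' : Subfield ℂ) (b : ℕ → Circ → ℂ) : (ℝ → CoeffSeq) → Prop
  | pos (c : ℝ → CoeffSeq) (hc : IsPolynomialSeq F' b c) : IsStarProduct F' b c
  | neg (c : ℝ → CoeffSeq) (hc : IsPolynomialSeq F' b c) :
      IsStarProduct F' b fun t => inv (c t)
  | mul (P Q : ℝ → CoeffSeq) (hP : IsStarProduct F' b P) (hQ : IsStarProduct F' b Q) :
      IsStarProduct F' b fun t => starProd (P t) (Q t)

/-- `X_{F'}(b)`-polynomial maps `P : [0,1] → X`.  Equality of `P(t)` with a `*`-product is equality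
in `L^∞`, that is, almost everywhere. -/
def IsPolynomialMap (F' : Subfield ℂ) (b : ℕ → Circ → ℂ) (P : Icc (0 : ℝ) 1 → X) : Prop :=
  ∃ Q : ℝ → CoeffSeq, IsStarProduct F' b Q ∧
    ∀ (t : Icc (0 : ℝ) 1) (k : ℕ), (P t).1 k =ᵐ[volume] Q t k

/-- The arc `[P] : [0,1] → G(X)`, `t ↦ [P(t)]`. -/
def arc (P : Icc (0 : ℝ) 1 → X) (t : Icc (0 : ℝ) 1) : G := cls (P t)

end CenterProblem

namespace CenterProblem

/-! The equation has a first integral $H(x,y)=\sum_n h_n(x)y^{n+1}$ with $H(0,y)=y$ and $H_x+(\sum_i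
a_i y^{i+2})H_y=0$. It is constant along small solutions, so $H(2\pi,\cdot)$ inverts the return map,
and $a$ determines a center exactly when $h_{n+1}(2\pi)=0$ for all $n$
(`IsCenter.firstIntegral_eq_zero`, `isCenter_of_firstIntegral_eq_zero`). Comparing powers of $y$
gives a recursion that makes $h_n(2\pi)$ a finite integer combination of basic iterated integrals
(`returnCoeff`).

These integrals depend only on the class (`Equivalent.iteratedIntegral_eq`): by Chen's formula the
product of paths becomes the concatenation product of functions on words, where the integrals of
$b^{-1}$ form the left inverse of those of $b$.

Along a polynomial map every basic iterated integral is a polynomial in $t$ over $F'$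
(`IsStarProduct.integrableSeq_and_mem_polyFun`): for one factor, expand by multilinearity into
iterated integrals of $\hat b$, which lie in $F\subseteq F'$; then pass to inverses and products by
Chen's formula. Hence each $h_{n+1}(2\pi)$ is such a polynomial. One of them is nonzero at $t=0$ and
all vanish at $\xi$, so $\xi$ is a root of a nonzero polynomial over $F'$. -/

/-! ### Integrability and basic properties of iterated integrals -/

/-- Every component is Lebesgue integrable over the circle, parametrized by `[0, 2π]`. -/
def IntegrableSeq (a : CoeffSeq) : Prop :=
  ∀ i, IntervalIntegrable (fun s : ℝ => a i (s : Circ)) volume 0 (2 * π)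

theorem IntegrableSeq.continuousOn_nestedIntegral {a : CoeffSeq} (ha : IntegrableSeq a)
    (w : List ℕ) : ContinuousOn (nestedIntegral a w) (uIcc 0 (2 * π)) := by
  induction w with
  | nil => exact continuousOn_const
  | cons i w ih =>
    exact intervalIntegral.continuousOn_primitive_interval' ((ha i).mul_continuousOn ih)
      left_mem_uIcc

theorem IntegrableSeq.mul_nestedIntegral {a : CoeffSeq} (ha : IntegrableSeq a)
    (i : ℕ) (w : List ℕ) :
    IntervalIntegrable (fun s : ℝ => a i (s : Circ) * nestedIntegral a w s) volume 0 (2 * π) :=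
  (ha i).mul_continuousOn (ha.continuousOn_nestedIntegral w)

theorem uIcc_subset_of_mem {x y : ℝ} (hx : x ∈ Icc 0 (2 * π)) (hy : y ∈ Icc 0 (2 * π)) :
    uIcc x y ⊆ uIcc 0 (2 * π) := by
  rw [uIcc_of_le Real.two_pi_pos.le]
  exact Set.uIcc_subset_Icc hx hy

theorem zero_mem_Icc_two_pi : (0 : ℝ) ∈ Icc 0 (2 * π) := ⟨le_rfl, Real.two_pi_pos.le⟩

theorem two_pi_mem_Icc : (2 * π : ℝ) ∈ Icc 0 (2 * π) := ⟨Real.two_pi_pos.le, le_rfl⟩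

theorem nestedIntegral_zero (a : CoeffSeq) {w : List ℕ} (hw : w ≠ []) :
    nestedIntegral a w 0 = 0 := by
  cases w with
  | nil => exact absurd rfl hw
  | cons i w => simp [nestedIntegral]

theorem iteratedIntegral_nil (a : CoeffSeq) : iteratedIntegral [] a = 1 := rfl

theorem ae_restrict_of_ae_circ {p : Circ → Prop} (h : ∀ᵐ x ∂(volume : Measure Circ), p x) :
    ∀ᵐ s : ℝ, s ∈ Ioc 0 (2 * π) → p (s : Circ) := by
  have := (AddCircle.measurePreserving_mk (2 * π) 0).quasiMeasurePreserving.ae h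
  rw [zero_add] at this
  exact (ae_restrict_iff' measurableSet_Ioc).1 this

theorem nestedIntegral_congr {a b : CoeffSeq}
    (h : ∀ i, ∀ᵐ s : ℝ, s ∈ Ioc 0 (2 * π) → a i (s : Circ) = b i (s : Circ)) (w : List ℕ)
    {x : ℝ} (hx : x ∈ Icc 0 (2 * π)) : nestedIntegral a w x = nestedIntegral b w x := by
  induction w generalizing x with
  | nil => rfl
  | cons i w ih =>
    refine intervalIntegral.integral_congr_ae ?_
    filter_upwards [h i] with s hs hsx
    rw [uIoc_of_le hx.1] at hsx
    rw [hs ⟨hsx.1, hsx.2.trans hx.2⟩, ih ⟨hsx.1.le, hsx.2.trans hx.2⟩]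

theorem iteratedIntegral_congr {a b : CoeffSeq} (h : ∀ i, a i =ᵐ[volume] b i) (w : List ℕ) :
    iteratedIntegral w a = iteratedIntegral w b :=
  nestedIntegral_congr (fun i => ae_restrict_of_ae_circ (h i)) w two_pi_mem_Icc

theorem MemX.integrableSeq {a : CoeffSeq} (ha : MemX a) : IntegrableSeq a := by
  intro i
  obtain ⟨hm, l, -, hl⟩ := ha
  have hmp := AddCircle.measurePreserving_mk (2 * π) 0
  rw [zero_add] at hmp
  rw [intervalIntegrable_iff_integrableOn_Ioc_of_le Real.two_pi_pos.le]
  exact Integrable.of_bound ((hm i).comp_measurePreserving hmp) (l ^ (i + 1))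
    (hmp.quasiMeasurePreserving.ae (hl i))

/-! ### Concatenation product of functions on words -/

/-- The product `∑_{w = u ++ v} J u * K v` dual to concatenation of words. -/
def concatProd : (List ℕ → ℂ) → (List ℕ → ℂ) → List ℕ → ℂ
  | J, K, [] => J [] * K []
  | J, K, i :: w => J [] * K (i :: w) + concatProd (fun u => J (i :: u)) K w

theorem concatProd_congr_right (J : List ℕ → ℂ) {K K' : List ℕ → ℂ} {w : List ℕ}
    (h : ∀ v, v.length ≤ w.length → K v = K' v) : concatProd J K w = concatProd J K' w := by
  induction w generalizing J with
  | nil => simp [concatProd, h [] le_rfl]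
  | cons i w ih =>
    simp only [concatProd]
    rw [h _ le_rfl, ih _ fun v hv => h v (hv.trans (by simp))]

/-- The system is triangular: `K w` enters with coefficient `J [] = 1`, and all other terms involve
`K` only at shorter words. -/
theorem concatProd_left_cancel {J K K' : List ℕ → ℂ} (hJ : J [] = 1)
    (h : ∀ w, concatProd J K w = concatProd J K' w) (w : List ℕ) : K w = K' w := by
  induction hn : w.length using Nat.strong_induction_on generalizing w with
  | _ n ih =>
    have hw := h w
    cases w with
    | nil => simpa [concatProd, hJ] using hw
    | cons i w =>
      simp only [concatProd, hJ, one_mul] at hw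
      rw [concatProd_congr_right (fun u => J (i :: u)) (K := K) (K' := K') fun v hv =>
        ih v.length (by simp at hn; omega) v rfl] at hw
      exact add_right_cancel hw

/-- `concatProd` is a finite sum, linear in its first argument, so it commutes with integration. -/
theorem integral_mul_concatProd {f : ℝ → ℂ} {x y : ℝ} (K : List ℕ → ℂ) (w : List ℕ)
    {N : List ℕ → ℝ → ℂ} (hN : ∀ u, IntervalIntegrable (fun s => f s * N u s) volume x y) :
    IntervalIntegrable (fun s => f s * concatProd (fun u => N u s) K w) volume x y ∧
      ∫ s in x..y, f s * concatProd (fun u => N u s) K w =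
        concatProd (fun u => ∫ s in x..y, f s * N u s) K w := by
  induction w generalizing N with
  | nil =>
    simp only [concatProd, ← mul_assoc]
    exact ⟨(hN []).mul_const _, intervalIntegral.integral_mul_const _ _⟩
  | cons i w ih =>
    obtain ⟨h1, h2⟩ := ih fun u => hN (i :: u)
    simp only [concatProd, mul_add, ← mul_assoc]
    refine ⟨((hN []).mul_const _).add h1, ?_⟩
    rw [intervalIntegral.integral_add ((hN []).mul_const _) h1, h2,
      intervalIntegral.integral_mul_const]

/-! ### Iterated integrals of products and inverses -/

theorem starProd_coe_of_le (a b : CoeffSeq) (i : ℕ) {s : ℝ} (h0 : 0 < s) (h : s ≤ π) :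
    starProd a b i (s : Circ) = 2 * a i ((2 * s : ℝ) : Circ) := by
  have : s ∈ Ioc 0 (2 * π) := ⟨h0, by linarith⟩
  rw [starProd, AddCircle.liftIoc_zero_coe_apply this, if_pos h]

theorem starProd_coe_of_lt (a b : CoeffSeq) (i : ℕ) {s : ℝ} (h0 : π < s) (h : s ≤ 2 * π) :
    starProd a b i (s : Circ) = 2 * b i ((2 * s - 2 * π : ℝ) : Circ) := by
  have : s ∈ Ioc 0 (2 * π) := ⟨Real.pi_pos.trans h0, h⟩
  rw [starProd, AddCircle.liftIoc_zero_coe_apply this, if_neg h0.not_ge]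

theorem inv_coe (a : CoeffSeq) (i : ℕ) {s : ℝ} (hs : s ∈ Ioc 0 (2 * π)) :
    inv a i (s : Circ) = - a i ((2 * π - s : ℝ) : Circ) := by
  rw [inv, AddCircle.liftIoc_zero_coe_apply hs]

theorem IntegrableSeq.inv {a : CoeffSeq} (ha : IntegrableSeq a) : IntegrableSeq (inv a) := by
  intro i
  have h := ((ha i).comp_sub_left (2 * π)).symm.neg
  simp only [sub_self, sub_zero] at h
  refine h.congr fun s hs => ?_
  rw [uIoc_of_le Real.two_pi_pos.le] at hs
  simp [inv_coe a i hs]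

theorem IntegrableSeq.starProd {a b : CoeffSeq} (ha : IntegrableSeq a) (hb : IntegrableSeq b) :
    IntegrableSeq (starProd a b) := by
  intro i
  refine IntervalIntegrable.trans (b := π) ?_ ?_
  · have h := ((ha i).comp_mul_left (c := 2)).const_mul 2
    rw [zero_div, mul_div_cancel_left₀ _ (two_ne_zero' ℝ)] at h
    refine h.congr fun s hs => ?_
    rw [uIoc_of_le Real.pi_pos.le] at hs
    simp only [starProd_coe_of_le a b i hs.1 hs.2]
  · have h := (((hb i).comp_sub_right (2 * π)).comp_mul_left (c := 2)).const_mul 2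
    rw [zero_add, mul_div_cancel_left₀ _ (two_ne_zero' ℝ), ← two_mul,
      mul_div_cancel_left₀ _ (two_ne_zero' ℝ)] at h
    refine h.congr fun s hs => ?_
    rw [uIoc_of_le (by linarith [Real.pi_pos])] at hs
    simp only [starProd_coe_of_lt a b i hs.1 hs.2]

theorem nestedIntegral_starProd_of_le (a b : CoeffSeq) (w : List ℕ) {x : ℝ} (hx : x ∈ Icc 0 π) :
    nestedIntegral (starProd a b) w x = nestedIntegral a w (2 * x) := by
  induction w generalizing x with
  | nil => rfl
  | cons i w ih =>
    have : nestedIntegral (starProd a b) (i :: w) x =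
        ∫ s in (0 : ℝ)..x, 2 * (a i ((2 * s : ℝ) : Circ) * nestedIntegral a w (2 * s)) := by
      refine intervalIntegral.integral_congr_ae (Filter.Eventually.of_forall fun s hs => ?_)
      rw [uIoc_of_le hx.1] at hs
      simp only [starProd_coe_of_le a b i hs.1 (hs.2.trans hx.2), ih ⟨hs.1.le, hs.2.trans hx.2⟩]
      ring
    rw [this, intervalIntegral.integral_const_mul, intervalIntegral.integral_comp_mul_left
      (fun s : ℝ => a i (s : Circ) * nestedIntegral a w s) (two_ne_zero' ℝ)]
    simp [nestedIntegral]

/-- Chen's formula. The head of a word carries the latest time, so after time `π` a prefix is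
integrated along `b` and the remaining suffix has been completed along `a`. The factor 2 in the
product cancels the Jacobian. -/
theorem nestedIntegral_starProd_of_ge {a b : CoeffSeq} (ha : IntegrableSeq a)
    (hb : IntegrableSeq b) (w : List ℕ) {x : ℝ} (hx : x ∈ Icc π (2 * π)) :
    nestedIntegral (starProd a b) w x =
      concatProd (fun u => nestedIntegral b u (2 * x - 2 * π))
        (fun v => iteratedIntegral v a) w := by
  induction w generalizing x with
  | nil => simp [concatProd, nestedIntegral, iteratedIntegral_nil]
  | cons i w ih =>
    have hpi := Real.pi_pos
    have hxI : x ∈ Icc 0 (2 * π) := ⟨hpi.le.trans hx.1, hx.2⟩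
    have hpI : π ∈ Icc 0 (2 * π) := ⟨hpi.le, by linarith⟩
    have hint := (ha.starProd hb).mul_nestedIntegral i w
    have hsplit : nestedIntegral (starProd a b) (i :: w) x =
        nestedIntegral (starProd a b) (i :: w) π +
          ∫ s in π..x, starProd a b i (s : Circ) * nestedIntegral (starProd a b) w s :=
      (intervalIntegral.integral_add_adjacent_intervals
        (hint.mono_set (uIcc_subset_of_mem zero_mem_Icc_two_pi hpI))
        (hint.mono_set (uIcc_subset_of_mem hpI hxI))).symm
    have hsecond : (∫ s in π..x, starProd a b i (s : Circ) *
        nestedIntegral (starProd a b) w s) =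
        ∫ s in π..x, 2 * (fun s : ℝ => b i (s : Circ) * concatProd
          (fun u => nestedIntegral b u s) (fun v => iteratedIntegral v a) w)
            (2 * s - 2 * π) := by
      refine intervalIntegral.integral_congr_ae (Filter.Eventually.of_forall fun s hs => ?_)
      rw [uIoc_of_le hx.1] at hs
      simp only [starProd_coe_of_lt a b i hs.1 (hs.2.trans hx.2), ih ⟨hs.1.le, hs.2.trans hx.2⟩]
      ring
    rw [hsplit, hsecond, nestedIntegral_starProd_of_le a b _ ⟨hpi.le, le_rfl⟩,
      intervalIntegral.integral_const_mul, intervalIntegral.integral_comp_mul_sub (fun s : ℝ => b i (s : Circ) *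
        concatProd (fun u => nestedIntegral b u s) (fun v => iteratedIntegral v a) w)
        (two_ne_zero' ℝ)]
    have hy : 2 * x - 2 * π ∈ Icc 0 (2 * π) := ⟨by linarith [hx.1], by linarith [hx.2]⟩
    have := (integral_mul_concatProd (fun v => iteratedIntegral v a) w
      (f := fun s : ℝ => b i (s : Circ)) (N := nestedIntegral b) (x := 0) (y := 2 * x - 2 * π)
      fun u => (hb.mul_nestedIntegral i u).mono_set (uIcc_subset_of_mem zero_mem_Icc_two_pi hy)).2
    rw [sub_self, this]
    simp [concatProd, nestedIntegral, iteratedIntegral]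

theorem iteratedIntegral_starProd {a b : CoeffSeq} (ha : IntegrableSeq a)
    (hb : IntegrableSeq b) (w : List ℕ) :
    iteratedIntegral w (starProd a b) =
      concatProd (fun u => iteratedIntegral u b) (fun v => iteratedIntegral v a) w := by
  have := nestedIntegral_starProd_of_ge ha hb w (x := 2 * π)
    ⟨by linarith [Real.pi_pos], le_rfl⟩
  rw [iteratedIntegral, this]
  simp only [iteratedIntegral]
  ring_nf

/-- Following `a` and then part of its reverse amounts to stopping `a` earlier, at `2 * π - x`. The
variable `x` is kept free so that the induction on the word can integrate the identity. -/
theorem concatProd_nestedIntegral_inv {a : CoeffSeq} (ha : IntegrableSeq a) (w : List ℕ)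
    {x : ℝ} (hx : x ∈ Icc 0 (2 * π)) :
    concatProd (fun u => nestedIntegral (inv a) u x) (fun v => iteratedIntegral v a) w =
      nestedIntegral a w (2 * π - x) := by
  induction w generalizing x with
  | nil => simp [concatProd, nestedIntegral, iteratedIntegral_nil]
  | cons i w ih =>
    have hy : 2 * π - x ∈ Icc 0 (2 * π) := ⟨by linarith [hx.2], by linarith [hx.1]⟩
    have hint := ha.mul_nestedIntegral i w
    have h1 := (integral_mul_concatProd (fun v => iteratedIntegral v a) w
      (f := fun s : ℝ => inv a i (s : Circ)) (N := nestedIntegral (inv a)) (x := 0) (y := x)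
      fun u => (ha.inv.mul_nestedIntegral i u).mono_set
        (uIcc_subset_of_mem zero_mem_Icc_two_pi hx)).2
    have h2 : (∫ s in (0 : ℝ)..x, inv a i (s : Circ) *
        concatProd (fun u => nestedIntegral (inv a) u s) (fun v => iteratedIntegral v a) w) =
        ∫ s in (0 : ℝ)..x, -(fun s : ℝ => a i (s : Circ) * nestedIntegral a w s)
          (2 * π - s) := by
      refine intervalIntegral.integral_congr_ae (Filter.Eventually.of_forall fun s hs => ?_)
      rw [uIoc_of_le hx.1] at hs
      simp only [inv_coe a i ⟨hs.1, hs.2.trans hx.2⟩, ih ⟨hs.1.le, hs.2.trans hx.2⟩]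
      ring
    have h3 := intervalIntegral.integral_add_adjacent_intervals
      (hint.mono_set (uIcc_subset_of_mem zero_mem_Icc_two_pi hy))
      (hint.mono_set (uIcc_subset_of_mem hy two_pi_mem_Icc))
    rw [intervalIntegral.integral_neg, intervalIntegral.integral_comp_sub_left
      (fun s : ℝ => a i (s : Circ) * nestedIntegral a w s), h1, sub_zero] at h2
    simp only [concatProd, nestedIntegral, iteratedIntegral, one_mul] at h2 ⊢
    rw [h2, ← h3]
    ring

/-- The inverse path gives the left inverse for the concatenation product. -/
theorem concatProd_iteratedIntegral_inv {a : CoeffSeq} (ha : IntegrableSeq a) (w : List ℕ) :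
    concatProd (fun u => iteratedIntegral u (inv a)) (fun v => iteratedIntegral v a) w =
      if w = [] then 1 else 0 := by
  have := concatProd_nestedIntegral_inv ha w two_pi_mem_Icc
  simp only [iteratedIntegral] at this ⊢
  rw [this, sub_self]
  split_ifs with h
  · rw [h]; rfl
  · exact nestedIntegral_zero a h

/-- Multiplied on the left by the integrals of `b⁻¹`, those of `a` and those of `b` both give the
unit; the left factor then cancels. -/
theorem Equivalent.iteratedIntegral_eq {a b : X} (h : Equivalent a b) (w : List ℕ) :
    iteratedIntegral w a.1 = iteratedIntegral w b.1 := by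
  have ha := a.2.integrableSeq
  have hb := b.2.integrableSeq
  refine concatProd_left_cancel (J := fun u => iteratedIntegral u (inv b.1))
    (K := fun v => iteratedIntegral v a.1) (K' := fun v => iteratedIntegral v b.1) rfl
    (fun w => ?_) w
  rw [concatProd_iteratedIntegral_inv hb, ← iteratedIntegral_starProd ha hb.inv]
  split_ifs with hw
  · rw [hw]; rfl
  · exact h w hw

theorem iteratedIntegral_eq_of_cls_eq {a b : X} (h : cls a = cls b) (w : List ℕ) :
    iteratedIntegral w a.1 = iteratedIntegral w b.1 :=
  congrArg (Quot.lift (fun c : X => iteratedIntegral w c.1) fun _ _ hcd =>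
    hcd.iteratedIntegral_eq w) h

/-! ### Coefficients of the first integral -/

/-- A linear functional on functions on words; its values on iterated
integrals are the coefficients of the inverse of the first return map. -/
noncomputable def returnCoeff : ℕ → (List ℕ → ℂ) → ℂ
  | 0, J => J []
  -- The term `(m + 1) h_m y ^ m` of `H_y` meets `a_i y ^ (i + 2)` in degree `n + 2` exactly when `i
  -- = n - m`.
  | n + 1, J => -∑ m : Fin (n + 1), ((m : ℕ) + 1 : ℂ) *
      returnCoeff m fun u => J ((n - (m : ℕ)) :: u)
termination_by n => n
decreasing_by exact m.2

theorem returnCoeff_zero (J : List ℕ → ℂ) : returnCoeff 0 J = J [] := by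
  rw [returnCoeff]

theorem returnCoeff_succ (n : ℕ) (J : List ℕ → ℂ) :
    returnCoeff (n + 1) J =
      -∑ m ∈ Finset.range (n + 1), ((m : ℂ) + 1) * returnCoeff m fun u => J ((n - m) :: u) := by
  rw [returnCoeff, Finset.sum_range]

theorem integral_mul_returnCoeff {f : ℝ → ℂ} {x y : ℝ} (n : ℕ)
    {N : List ℕ → ℝ → ℂ} (hN : ∀ u, IntervalIntegrable (fun s => f s * N u s) volume x y) :
    IntervalIntegrable (fun s => f s * returnCoeff n (fun u => N u s)) volume x y ∧
      ∫ s in x..y, f s * returnCoeff n (fun u => N u s) =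
        returnCoeff n fun u => ∫ s in x..y, f s * N u s := by
  induction n using Nat.strong_induction_on generalizing N with
  | _ n ih =>
    cases n with
    | zero =>
      simpa [returnCoeff_zero] using hN []
    | succ n =>
      have key : ∀ m ∈ Finset.range (n + 1), IntervalIntegrable (fun s => ((m : ℂ) + 1) *
          (f s * returnCoeff m fun u => N ((n - m) :: u) s)) volume x y := fun m hm =>
        (ih m (Finset.mem_range.1 hm) fun u => hN _).1.const_mul _
      have heq : (fun s => f s * returnCoeff (n + 1) (fun u => N u s)) = fun s =>
          -∑ m ∈ Finset.range (n + 1), ((m : ℂ) + 1) *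
          (f s * returnCoeff m fun u => N ((n - m) :: u) s) := by
        funext s
        rw [returnCoeff_succ, mul_neg, Finset.mul_sum]
        exact congrArg _ (Finset.sum_congr rfl fun m _ => by ring)
      rw [heq]
      refine ⟨(IntervalIntegrable.sum _ key).neg.congr fun s _ => by simp, ?_⟩
      rw [intervalIntegral.integral_neg, intervalIntegral.integral_finsetSum key,
        returnCoeff_succ]
      refine congrArg _ (Finset.sum_congr rfl fun m hm => ?_)
      rw [intervalIntegral.integral_const_mul,
        (ih m (Finset.mem_range.1 hm) fun u => hN ((n - m) :: u)).2]

/-- The coefficient `hₙ(x)` of `y ^ (n + 1)` in the first integral `H(x, y)` of the equation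
`v' = ∑ aᵢ(x) v ^ (i + 2)` normalized by `H(0, y) = y`. -/
noncomputable def firstIntegral (a : CoeffSeq) (n : ℕ) (x : ℝ) : ℂ :=
  returnCoeff n fun w => nestedIntegral a w x

theorem firstIntegral_zero (a : CoeffSeq) (x : ℝ) : firstIntegral a 0 x = 1 :=
  returnCoeff_zero _

/-- The derivative of `firstIntegral a n`, which is the coefficient of `y ^ (n + 1)` in
`-(∑ aᵢ y ^ (i + 2)) ∂H/∂y`. -/
noncomputable def firstIntegralDeriv (a : CoeffSeq) : ℕ → ℝ → ℂ
  | 0, _ => 0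
  | n + 1, x => -∑ m ∈ Finset.range (n + 1), ((m : ℂ) + 1) *
      (a (n - m) (x : Circ) * firstIntegral a m x)

/-- The transport equation in integrated form, one power of `y` at a time. -/
theorem IntegrableSeq.firstIntegral_succ {a : CoeffSeq} (ha : IntegrableSeq a) (n : ℕ) {x : ℝ}
    (hx : x ∈ Icc 0 (2 * π)) :
    IntervalIntegrable (firstIntegralDeriv a (n + 1)) volume 0 (2 * π) ∧
    firstIntegral a (n + 1) x = ∫ s in (0 : ℝ)..x, firstIntegralDeriv a (n + 1) s := by
  have key : ∀ {x : ℝ}, x ∈ Icc 0 (2 * π) → ∀ m, _ := fun {x} hx m =>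
    integral_mul_returnCoeff (x := 0) (y := x) (f := fun s => a (n - m) (s : Circ)) m
    fun u => (ha.mul_nestedIntegral (n - m) u).mono_set
      (uIcc_subset_of_mem zero_mem_Icc_two_pi hx)
  constructor
  · exact (IntervalIntegrable.sum (Finset.range (n + 1)) fun m _ =>
      (key two_pi_mem_Icc m).1.const_mul ((m : ℂ) + 1)).neg.congr
      fun s _ => by simp [firstIntegralDeriv, firstIntegral]
  · simp only [firstIntegralDeriv, firstIntegral]
    rw [intervalIntegral.integral_neg, intervalIntegral.integral_finsetSum
      fun m _ => (key hx m).1.const_mul ((m : ℂ) + 1), returnCoeff_succ]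
    refine congrArg _ (Finset.sum_congr rfl fun m hm => ?_)
    rw [intervalIntegral.integral_const_mul, (key hx m).2]
    rfl

theorem firstIntegral_at_zero {a : CoeffSeq} (ha : IntegrableSeq a) (n : ℕ) :
    firstIntegral a (n + 1) 0 = 0 := by
  rw [(ha.firstIntegral_succ n zero_mem_Icc_two_pi).2, intervalIntegral.integral_same]

theorem IntegrableSeq.ae_hasDerivAt_firstIntegral {a : CoeffSeq} (ha : IntegrableSeq a) :
    ∀ᵐ x : ℝ, x ∈ Ioo 0 (2 * π) →
      ∀ n, HasDerivAt (firstIntegral a n) (firstIntegralDeriv a n x) x := by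
  have h := ae_all_iff.2 fun n =>
    (ha.firstIntegral_succ n zero_mem_Icc_two_pi).1.ae_hasDerivAt_integral
  filter_upwards [h] with x hx hxI n
  cases n with
  | zero =>
    have : firstIntegral a 0 = fun _ => 1 := funext (firstIntegral_zero a)
    rw [this]
    exact hasDerivAt_const x _
  | succ n =>
    refine (hx n ?_ 0 left_mem_uIcc).congr_of_eventuallyEq ?_
    · rw [uIcc_of_le Real.two_pi_pos.le]
      exact Ioo_subset_Icc_self hxI
    · filter_upwards [Ioo_mem_nhds hxI.1 hxI.2] with y hy
      exact (ha.firstIntegral_succ n (Ioo_subset_Icc_self hy)).2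

/-! ### Growth of the coefficients of the first integral -/

theorem sum_range_pow_le_two_mul {B : ℝ} (hB : 2 ≤ B) (n : ℕ) :
    ∑ m ∈ Finset.range (n + 1), B ^ m ≤ 2 * B ^ n := by
  induction n with
  | zero => simp
  | succ n ih =>
    rw [Finset.sum_range_succ]
    have : 0 ≤ B ^ n := by positivity
    rw [pow_succ]
    nlinarith

theorem norm_firstIntegralDeriv_le {a : CoeffSeq} {l B s : ℝ} (hl : 0 < l) (hB : 2 ≤ B) (n : ℕ)
    (ha : ∀ i, ‖a i (s : Circ)‖ ≤ l ^ (i + 1))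
    (hh : ∀ m ≤ n, ‖firstIntegral a m s‖ ≤ (l * B) ^ m) :
    ‖firstIntegralDeriv a (n + 1) s‖ ≤ l ^ (n + 1) * ((n + 1) * (2 * B ^ n)) := by
  rw [firstIntegralDeriv, norm_neg]
  calc _ ≤ ∑ m ∈ Finset.range (n + 1), l ^ (n + 1) * ((n + 1) * B ^ m) := by
        refine norm_sum_le_of_le _ fun m hm => ?_
        have hmn : m ≤ n := Nat.lt_succ_iff.1 (Finset.mem_range.1 hm)
        rw [norm_mul, norm_mul]
        have h1 : ‖(m : ℂ) + 1‖ = m + 1 := by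
          rw [← Nat.cast_add_one, Complex.norm_natCast, Nat.cast_add_one]
        rw [h1]
        have hB0 : 0 ≤ B := by linarith
        calc ((m : ℝ) + 1) * (‖a (n - m) (s : Circ)‖ * ‖firstIntegral a m s‖)
            ≤ ((n : ℝ) + 1) * (l ^ (n - m + 1) * (l * B) ^ m) := by
              gcongr
              · exact ha _
              · exact hh m hmn
          _ = (l ^ (n - m + 1) * l ^ m) * (((n : ℝ) + 1) * B ^ m) := by rw [mul_pow]; ring
          _ = _ := by rw [← pow_add]; congr 2; omega
    _ = l ^ (n + 1) * ((n + 1) * ∑ m ∈ Finset.range (n + 1), B ^ m) := by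
        rw [Finset.mul_sum, Finset.mul_sum]
    _ ≤ _ := by gcongr; exact sum_range_pow_le_two_mul hB n

/-- The majorant reproduces itself: `2 * (n + 1) * (2 + 2 * s) ^ n` is both the derivative of `(2 +
2 * s) ^ (n + 1)` and, up to the power of `l`, the bound of `norm_firstIntegralDeriv_le` with `B = 2
+ 2 * s`. -/
theorem norm_firstIntegral_le {a : CoeffSeq} (ha : IntegrableSeq a) {l : ℝ} (hl : 0 < l)
    (hal : ∀ᵐ s : ℝ, s ∈ Ioc 0 (2 * π) → ∀ i, ‖a i (s : Circ)‖ ≤ l ^ (i + 1)) (n : ℕ) {x : ℝ}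
    (hx : x ∈ Icc 0 (2 * π)) : ‖firstIntegral a n x‖ ≤ (l * (2 + 2 * x)) ^ n := by
  induction n using Nat.strong_induction_on generalizing x with
  | _ n ih =>
    cases n with
    | zero => simp [firstIntegral_zero]
    | succ n =>
      rw [(ha.firstIntegral_succ n hx).2]
      have hint : IntervalIntegrable
          (fun s : ℝ => l ^ (n + 1) * ((n + 1) * (2 * (2 + 2 * s) ^ n))) volume 0 x :=
        Continuous.intervalIntegrable (by fun_prop) _ _
      have hprim : ∫ s in (0 : ℝ)..x, l ^ (n + 1) * ((n + 1) * (2 * (2 + 2 * s) ^ n)) =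
          l ^ (n + 1) * (2 + 2 * x) ^ (n + 1) - l ^ (n + 1) * (2 + 2 * 0) ^ (n + 1) := by
        refine intervalIntegral.integral_eq_sub_of_hasDerivAt
          (f := fun s => l ^ (n + 1) * (2 + 2 * s) ^ (n + 1)) (fun s _ => ?_) hint
        have h1 : HasDerivAt (fun s : ℝ => 2 + 2 * s) 2 s := by
          simpa using ((hasDerivAt_id s).const_mul 2).const_add 2
        convert! (h1.pow (n + 1)).const_mul (l ^ (n + 1)) using 1
        push_cast
        ring
      refine (intervalIntegral.norm_integral_le_of_norm_le hx.1 ?_ hint).trans ?_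
      · filter_upwards [hal] with s hs hsx
        have hsI : s ∈ Ioc 0 (2 * π) := ⟨hsx.1, hsx.2.trans hx.2⟩
        exact norm_firstIntegralDeriv_le hl (by linarith [hsx.1]) n (hs hsI) fun m hm =>
          ih m (Nat.lt_succ_iff.2 hm) ⟨hsI.1.le, hsI.2⟩
      · rw [hprim, mul_pow, sub_le_self_iff]
        positivity

theorem MemX.exists_firstIntegral_bounds {a : CoeffSeq} (ha : MemX a) :
    ∃ M : ℝ, 0 < M ∧
      (∀ᵐ s : ℝ, s ∈ Ioc 0 (2 * π) → ∀ i, ‖a i (s : Circ)‖ ≤ M ^ (i + 1)) ∧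
      (∀ n, ∀ x ∈ Icc 0 (2 * π), (n + 1) * ‖firstIntegral a n x‖ ≤ M ^ n) ∧
      ∀ n, ∀ x ∈ Icc 0 (2 * π), ∀ y ∈ Icc 0 (2 * π),
        ‖firstIntegral a n x - firstIntegral a n y‖ ≤ M ^ n * |x - y| := by
  obtain ⟨l, hl, hal⟩ := ha.2
  have hal' : ∀ᵐ s : ℝ, s ∈ Ioc 0 (2 * π) → ∀ i, ‖a i (s : Circ)‖ ≤ l ^ (i + 1) :=
    ae_restrict_of_ae_circ (ae_all_iff.2 hal)
  have hpi := Real.pi_pos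
  set B : ℝ := 2 + 2 * (2 * π) with hB
  have hB2 : 2 ≤ B := by linarith
  have hle : ∀ n, ∀ x ∈ Icc 0 (2 * π), ‖firstIntegral a n x‖ ≤ (l * B) ^ n := fun n x hx => by
    refine (norm_firstIntegral_le ha.integrableSeq hl hal' n hx).trans ?_
    have := hx.1
    have := hx.2
    gcongr
    linarith
  have hlB : l ≤ 2 * (l * B) := by nlinarith
  have htwo : ∀ n : ℕ, (n + 1 : ℝ) ≤ 2 ^ n := fun n => by
    exact_mod_cast Nat.lt_two_pow_self
  -- The extra factor `2 ^ n` absorbs the factor `n + 1` produced by differentiating in `y`.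
  refine ⟨2 * (l * B), by positivity, ?_, fun n x hx => ?_, fun n x hx y hy => ?_⟩
  · filter_upwards [hal'] with s hs hsI i
    exact (hs hsI i).trans (by gcongr)
  · rw [mul_pow]
    gcongr
    · exact htwo n
    · exact hle n x hx
  · cases n with
    | zero => simp [firstIntegral_zero]
    | succ n =>
      have hint := (ha.integrableSeq.firstIntegral_succ n hx).1
      rw [(ha.integrableSeq.firstIntegral_succ n hx).2,
        (ha.integrableSeq.firstIntegral_succ n hy).2, intervalIntegral.integral_interval_sub_left
        (hint.mono_set (uIcc_subset_of_mem zero_mem_Icc_two_pi hx))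
        (hint.mono_set (uIcc_subset_of_mem zero_mem_Icc_two_pi hy))]
      refine intervalIntegral.norm_integral_le_of_norm_le_const_ae ?_
      filter_upwards [hal'] with s hs hsI
      have hsI' : s ∈ Ioc 0 (2 * π) :=
        ⟨(le_min hy.1 hx.1).trans_lt hsI.1, hsI.2.trans (max_le hy.2 hx.2)⟩
      refine (norm_firstIntegralDeriv_le hl hB2 n (hs hsI') fun m _ =>
        hle m s ⟨hsI'.1.le, hsI'.2⟩).trans ?_
      calc l ^ (n + 1) * ((n + 1) * (2 * B ^ n)) ≤ l ^ (n + 1) * (2 ^ (n + 1) * (B * B ^ n)) := by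
            gcongr
            have := htwo (n + 1)
            push_cast at this
            linarith
        _ = _ := by rw [mul_pow, mul_pow]; ring

/-! ### The first integral `H(x, y) = ∑ hₙ(x) y ^ (n + 1)` -/

/-- Dominated convergence for difference quotients. Derivatives are needed only at the point `x`
itself, which suits coefficients differentiable merely almost everywhere. -/
theorem hasDerivAt_tsum_of_lipschitz {f : ℕ → ℝ → ℂ} {d : ℕ → ℂ} {C : ℕ → ℝ} {I : Set ℝ} {x : ℝ}
    (hI : I ∈ nhds x) (hC : Summable C)
    (hlip : ∀ n, ∀ y ∈ I, ‖f n y - f n x‖ ≤ C n * |y - x|)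
    (hf : ∀ y ∈ I, Summable fun n => f n y) (hd : ∀ n, HasDerivAt (f n) (d n) x) :
    HasDerivAt (fun y => ∑' n, f n y) (∑' n, d n) x := by
  rw [hasDerivAt_iff_tendsto_slope]
  have hI' : I ∈ nhdsWithin x {x}ᶜ := mem_nhdsWithin_of_mem_nhds hI
  have key : Filter.Tendsto (fun y => ∑' n, slope (f n) x y) (nhdsWithin x {x}ᶜ)
      (nhds (∑' n, d n)) := by
    refine tendsto_tsum_of_dominated_convergence hC
      (fun n => hasDerivAt_iff_tendsto_slope.1 (hd n)) ?_
    filter_upwards [hI', self_mem_nhdsWithin] with y hy hyx n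
    have hpos : 0 < |y - x| := abs_pos.2 (sub_ne_zero.2 hyx)
    rw [slope_def_module, norm_smul, norm_inv, Real.norm_eq_abs, inv_mul_le_iff₀ hpos, mul_comm]
    exact hlip n y hy
  refine key.congr' ?_
  filter_upwards [hI'] with y hy
  simp only [slope_def_module]
  rw [tsum_const_smul'', (hf y hy).tsum_sub (hf x (mem_of_mem_nhds hI))]

theorem norm_pow_succ_sub_pow_succ_le {y z : ℂ} {ρ : ℝ} (hy : ‖y‖ ≤ ρ) (hz : ‖z‖ ≤ ρ) (n : ℕ) :
    ‖y ^ (n + 1) - z ^ (n + 1)‖ ≤ (n + 1) * ρ ^ n * ‖y - z‖ := by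
  have hρ : 0 ≤ ρ := (norm_nonneg _).trans hy
  induction n with
  | zero => simp
  | succ n ih =>
    have h : y ^ (n + 2) - z ^ (n + 2) =
        y * (y ^ (n + 1) - z ^ (n + 1)) + (y - z) * z ^ (n + 1) := by ring
    rw [h]
    refine (norm_add_le _ _).trans ?_
    rw [norm_mul, norm_mul, norm_pow]
    calc ‖y‖ * ‖y ^ (n + 1) - z ^ (n + 1)‖ + ‖y - z‖ * ‖z‖ ^ (n + 1)
        ≤ ρ * ((n + 1) * ρ ^ n * ‖y - z‖) + ‖y - z‖ * ρ ^ (n + 1) := by gcongr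
      _ = _ := by push_cast; ring

/-- Uniform geometric bounds for the coefficients of an equation and of its first integral. -/
structure GrowthBound (a : CoeffSeq) (M : ℝ) : Prop where
  pos : 0 < M
  coeff : ∀ᵐ s : ℝ, s ∈ Ioc 0 (2 * π) → ∀ i, ‖a i (s : Circ)‖ ≤ M ^ (i + 1)
  bound : ∀ n, ∀ x ∈ Icc 0 (2 * π), (n + 1) * ‖firstIntegral a n x‖ ≤ M ^ n
  lipschitz : ∀ n, ∀ x ∈ Icc 0 (2 * π), ∀ y ∈ Icc 0 (2 * π),
    ‖firstIntegral a n x - firstIntegral a n y‖ ≤ M ^ n * |x - y|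

/-- The first integral `H(x, y)`. -/
noncomputable def firstIntegralSeries (a : CoeffSeq) (x : ℝ) (y : ℂ) : ℂ :=
  ∑' n, firstIntegral a n x * y ^ (n + 1)

namespace GrowthBound

variable {a : CoeffSeq} {M ρ : ℝ}

theorem norm_le (h : GrowthBound a M) (n : ℕ) {x : ℝ} (hx : x ∈ Icc 0 (2 * π)) :
    ‖firstIntegral a n x‖ ≤ M ^ n :=
  le_trans (le_mul_of_one_le_left (norm_nonneg _) (by linarith [n.cast_nonneg (α := ℝ)]))
    (h.bound n x hx)

theorem norm_term_sub_le (h : GrowthBound a M) (n : ℕ) {x x' : ℝ}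
    (hx : x ∈ Icc 0 (2 * π)) (hx' : x' ∈ Icc 0 (2 * π)) {y z : ℂ} (hy : ‖y‖ ≤ ρ) (hz : ‖z‖ ≤ ρ) :
    ‖firstIntegral a n x * y ^ (n + 1) - firstIntegral a n x' * z ^ (n + 1)‖ ≤
      (M * ρ) ^ n * (ρ * |x - x'| + ‖y - z‖) := by
  have hρ : 0 ≤ ρ := (norm_nonneg _).trans hy
  have hM := h.pos
  have heq : firstIntegral a n x * y ^ (n + 1) - firstIntegral a n x' * z ^ (n + 1) =
      (firstIntegral a n x - firstIntegral a n x') * y ^ (n + 1) +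
        firstIntegral a n x' * (y ^ (n + 1) - z ^ (n + 1)) := by ring
  rw [heq]
  refine (norm_add_le _ _).trans ?_
  rw [norm_mul, norm_mul, norm_pow]
  calc _ ≤ (M ^ n * |x - x'|) * ρ ^ (n + 1) +
        ‖firstIntegral a n x'‖ * ((n + 1) * ρ ^ n * ‖y - z‖) := by
        gcongr
        · exact h.lipschitz n x hx x' hx'
        · exact norm_pow_succ_sub_pow_succ_le hy hz n
    _ = (M ^ n * |x - x'|) * ρ ^ (n + 1) +
        ((n + 1) * ‖firstIntegral a n x'‖) * (ρ ^ n * ‖y - z‖) := by ring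
    _ ≤ (M ^ n * |x - x'|) * ρ ^ (n + 1) + M ^ n * (ρ ^ n * ‖y - z‖) := by
        gcongr
        exact h.bound n x' hx'
    _ = _ := by rw [mul_pow]; ring

theorem ratio_nonneg (h : GrowthBound a M) {y : ℂ} (hy : ‖y‖ ≤ ρ) : 0 ≤ M * ρ :=
  mul_nonneg h.pos.le ((norm_nonneg _).trans hy)

theorem summable_term (h : GrowthBound a M) (hρ : M * ρ ≤ 1 / 3) {x : ℝ}
    (hx : x ∈ Icc 0 (2 * π)) {y : ℂ} (hy : ‖y‖ ≤ ρ) :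
    Summable fun n => firstIntegral a n x * y ^ (n + 1) := by
  have hq := h.ratio_nonneg hy
  refine Summable.of_norm_bounded
    ((summable_geometric_of_lt_one hq (by linarith)).mul_right ‖y‖) fun n => ?_
  have := h.norm_term_sub_le n hx hx hy (z := 0) (by simpa using (norm_nonneg _).trans hy)
  simpa using this

theorem norm_series_sub_le (h : GrowthBound a M) (hρ : M * ρ ≤ 1 / 3) {x x' : ℝ}
    (hx : x ∈ Icc 0 (2 * π)) (hx' : x' ∈ Icc 0 (2 * π)) {y z : ℂ} (hy : ‖y‖ ≤ ρ) (hz : ‖z‖ ≤ ρ) :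
    ‖firstIntegralSeries a x y - firstIntegralSeries a x' z‖ ≤
      3 / 2 * (ρ * |x - x'| + ‖y - z‖) := by
  have hq := h.ratio_nonneg hy
  have hρ0 : 0 ≤ ρ := (norm_nonneg _).trans hy
  rw [firstIntegralSeries, firstIntegralSeries,
    ← (h.summable_term hρ hx hy).tsum_sub (h.summable_term hρ hx' hz)]
  refine (tsum_of_norm_bounded ((hasSum_geometric_of_lt_one hq (by linarith)).mul_right _)
    fun n => h.norm_term_sub_le n hx hx' hy hz).trans ?_
  gcongr
  rw [inv_le_comm₀ (by linarith) (by norm_num)]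
  linarith

theorem hasSum_geometric_succ {q : ℝ} (h0 : 0 ≤ q) (h1 : q ≤ 1 / 3) :
    ∃ s ≤ (1 / 2 : ℝ), HasSum (fun n : ℕ => q ^ (n + 1)) s := by
  refine ⟨q * (1 - q)⁻¹, ?_, ?_⟩
  · rw [← div_eq_mul_inv, div_le_iff₀ (by linarith)]
    linarith
  · simpa [pow_succ'] using (hasSum_geometric_of_lt_one h0 (by linarith)).mul_left q

/-- `H(x, ·)` is a perturbation of the identity: the terms after the first have total Lipschitz
constant at most `(1/3) / (1 - 1/3) = 1/2`. Injectivity, inversion and the a priori bound on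
solutions all rest on this. -/
theorem norm_series_sub_sub_le (h : GrowthBound a M) (hρ : M * ρ ≤ 1 / 3) {x : ℝ}
    (hx : x ∈ Icc 0 (2 * π)) {y z : ℂ} (hy : ‖y‖ ≤ ρ) (hz : ‖z‖ ≤ ρ) :
    ‖(firstIntegralSeries a x y - y) - (firstIntegralSeries a x z - z)‖ ≤ 1 / 2 * ‖y - z‖ := by
  have hq := h.ratio_nonneg hy
  obtain ⟨s, hs, hsum⟩ := hasSum_geometric_succ hq hρ
  have hsy := h.summable_term hρ hx hy
  have hsz := h.summable_term hρ hx hz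
  rw [firstIntegralSeries, firstIntegralSeries, hsy.tsum_eq_zero_add, hsz.tsum_eq_zero_add]
  simp only [firstIntegral_zero, zero_add, pow_one, one_mul, add_sub_cancel_left]
  rw [← ((summable_nat_add_iff 1).2 hsy).tsum_sub ((summable_nat_add_iff 1).2 hsz)]
  refine (tsum_of_norm_bounded (hsum.mul_right ‖y - z‖) fun n => ?_).trans (by gcongr)
  simpa using h.norm_term_sub_le (n + 1) hx hx hy hz

theorem series_zero_right (a : CoeffSeq) (x : ℝ) : firstIntegralSeries a x 0 = 0 := by
  simp [firstIntegralSeries]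

theorem norm_series_sub_self_le (h : GrowthBound a M) (hρ : M * ρ ≤ 1 / 3) {x : ℝ}
    (hx : x ∈ Icc 0 (2 * π)) {y : ℂ} (hy : ‖y‖ ≤ ρ) :
    ‖firstIntegralSeries a x y - y‖ ≤ 1 / 2 * ‖y‖ := by
  simpa [series_zero_right] using
    h.norm_series_sub_sub_le hρ hx hy (z := 0) (by simpa using (norm_nonneg _).trans hy)

/-- A quantitative injectivity of `H` in the second variable. -/
theorem norm_sub_le_series (h : GrowthBound a M) (hρ : M * ρ ≤ 1 / 3) {x : ℝ}
    (hx : x ∈ Icc 0 (2 * π)) {y z : ℂ} (hy : ‖y‖ ≤ ρ) (hz : ‖z‖ ≤ ρ) :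
    ‖y - z‖ ≤ 2 * ‖firstIntegralSeries a x y - firstIntegralSeries a x z‖ := by
  have h1 := h.norm_series_sub_sub_le hρ hx hy hz
  have h2 : y - z = (firstIntegralSeries a x y - firstIntegralSeries a x z) -
    ((firstIntegralSeries a x y - y) - (firstIntegralSeries a x z - z)) := by ring
  have h3 := norm_sub_le (firstIntegralSeries a x y - firstIntegralSeries a x z)
    ((firstIntegralSeries a x y - y) - (firstIntegralSeries a x z - z))
  rw [← h2] at h3
  linarith

/-! ### The transport equation -/

theorem norm_derivTerm_le (h : GrowthBound a M) {x : ℝ} (hx : x ∈ Icc 0 (2 * π)) {y : ℂ}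
    (hy : ‖y‖ ≤ ρ) (n : ℕ) :
    ‖((n : ℂ) + 1) * firstIntegral a n x * y ^ n‖ ≤ (M * ρ) ^ n := by
  have h1 : ‖(n : ℂ) + 1‖ = n + 1 := by
    rw [← Nat.cast_add_one, Complex.norm_natCast, Nat.cast_add_one]
  have := h.pos
  rw [norm_mul, norm_mul, norm_pow, h1, mul_pow]
  gcongr
  exact h.bound n x hx

/-- The leading term is 1 and the rest has norm at most `1/2`. Nonvanishing of `H_y` lets constancy
of `H` along a curve imply the differential equation. -/
theorem derivSeries_ne_zero (h : GrowthBound a M) (hρ : M * ρ ≤ 1 / 3) {x : ℝ}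
    (hx : x ∈ Icc 0 (2 * π)) {y : ℂ} (hy : ‖y‖ ≤ ρ) :
    ∑' n : ℕ, ((n : ℂ) + 1) * firstIntegral a n x * y ^ n ≠ 0 := by
  have hq := h.ratio_nonneg hy
  obtain ⟨s, hs, hsum⟩ := hasSum_geometric_succ hq hρ
  have hS : Summable fun n : ℕ => ((n : ℂ) + 1) * firstIntegral a n x * y ^ n :=
    .of_norm_bounded (summable_geometric_of_lt_one hq (by linarith)) (h.norm_derivTerm_le hx hy)
  intro h0
  rw [hS.tsum_eq_zero_add] at h0
  have h1 := tsum_of_norm_bounded hsum fun n => h.norm_derivTerm_le hx hy (n + 1)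
  simp only [Nat.cast_zero, zero_add, firstIntegral_zero, pow_zero, mul_one] at h0
  rw [← norm_neg, ← eq_neg_of_add_eq_zero_left h0, norm_one] at h1
  linarith

theorem norm_coeff_mul_pow_le {x : ℝ} (hM : 0 ≤ M) (ha : ∀ i, ‖a i (x : Circ)‖ ≤ M ^ (i + 1))
    {y : ℂ} (hy : ‖y‖ ≤ ρ) (i : ℕ) :
    ‖a i (x : Circ) * y ^ (i + 2)‖ ≤ (M * ρ) ^ i * (M * ρ * ρ) := by
  have : 0 ≤ ρ := (norm_nonneg _).trans hy
  rw [norm_mul, norm_pow]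
  calc _ ≤ M ^ (i + 1) * ρ ^ (i + 2) := by
        gcongr
        exact ha i
    _ = _ := by rw [mul_pow]; ring

/-- The recursion read backwards: a Cauchy product of `H_y` with the right-hand side of the
equation. -/
theorem hasSum_firstIntegralDeriv (h : GrowthBound a M) (hρ : M * ρ ≤ 1 / 3) {x : ℝ}
    (hx : x ∈ Icc 0 (2 * π)) (ha : ∀ i, ‖a i (x : Circ)‖ ≤ M ^ (i + 1)) {y : ℂ} (hy : ‖y‖ ≤ ρ) :
    HasSum (fun n => firstIntegralDeriv a n x * y ^ (n + 1))
      (-((∑' n : ℕ, ((n : ℂ) + 1) * firstIntegral a n x * y ^ n) *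
        ∑' i : ℕ, a i (x : Circ) * y ^ (i + 2))) := by
  have hq := h.ratio_nonneg hy
  have hg := summable_geometric_of_lt_one hq (by linarith)
  have h1 : Summable fun n : ℕ => ‖((n : ℂ) + 1) * firstIntegral a n x * y ^ n‖ :=
    .of_nonneg_of_le (fun _ => norm_nonneg _) (h.norm_derivTerm_le hx hy) hg
  have h2 : Summable fun i : ℕ => ‖a i (x : Circ) * y ^ (i + 2)‖ :=
    .of_nonneg_of_le (fun _ => norm_nonneg _) (norm_coeff_mul_pow_le h.pos.le ha hy)
      (hg.mul_right _)
  have key := (hasSum_sum_range_mul_of_summable_norm h1 h2).neg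
  refine (hasSum_nat_add_iff' 1).1 ?_
  simp only [Finset.range_one, Finset.sum_singleton, firstIntegralDeriv, zero_mul, sub_zero]
  refine key.congr_fun fun n => ?_
  rw [neg_mul, Finset.sum_mul]
  refine congrArg _ (Finset.sum_congr rfl fun m hm => ?_)
  have hmn : m ≤ n := Nat.lt_succ_iff.1 (Finset.mem_range.1 hm)
  have hexp : n + 1 + 1 = m + (n - m + 2) := by omega
  rw [hexp, pow_add]
  ring

/-- The derivative of `H` along a curve `v` is `H_y` times the defect of `v` in the equation. -/
theorem hasDerivAt_series_comp (h : GrowthBound a M) (hρ : M * ρ ≤ 1 / 3) {T x : ℝ}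
    (hT : T ≤ 2 * π) (hx : x ∈ Ioo 0 T) (ha : ∀ i, ‖a i (x : Circ)‖ ≤ M ^ (i + 1))
    (hd : ∀ n, HasDerivAt (firstIntegral a n) (firstIntegralDeriv a n x) x)
    {v : ℝ → ℂ} {K : ℝ} (hv : ∀ y ∈ Icc 0 T, ‖v y‖ ≤ ρ)
    (hK : ∀ y ∈ Icc 0 T, ∀ z ∈ Icc 0 T, ‖v y - v z‖ ≤ K * |y - z|) {D : ℂ}
    (hD : HasDerivAt v D x) :
    HasDerivAt (fun y => firstIntegralSeries a y (v y))
      ((∑' n : ℕ, ((n : ℂ) + 1) * firstIntegral a n x * v x ^ n) *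
        (D - ∑' i : ℕ, a i (x : Circ) * v x ^ (i + 2))) x := by
  have hsub : Icc 0 T ⊆ Icc 0 (2 * π) := Icc_subset_Icc_right hT
  have hxI : x ∈ Icc 0 T := Ioo_subset_Icc_self hx
  have hq := h.ratio_nonneg (hv x hxI)
  have hg := summable_geometric_of_lt_one hq (by linarith)
  have key := hasDerivAt_tsum_of_lipschitz (f := fun n y => firstIntegral a n y * v y ^ (n + 1))
    (I := Icc 0 T) (Icc_mem_nhds hx.1 hx.2) (hg.mul_right (ρ + K)) (fun n y hy => ?_)
    (fun y hy => h.summable_term hρ (hsub hy) (hv y hy))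
    (fun n => (hd n).mul (hD.pow (n + 1)))
  · refine key.congr_deriv ?_
    have hS : Summable fun n : ℕ => ((n : ℂ) + 1) * firstIntegral a n x * v x ^ n :=
      .of_norm_bounded hg (h.norm_derivTerm_le (hsub hxI) (hv x hxI))
    have := (h.hasSum_firstIntegralDeriv hρ (hsub hxI) ha (hv x hxI)).add (hS.hasSum.mul_right D)
    refine (tsum_congr fun n => ?_).trans (this.tsum_eq.trans (by ring))
    simp only [Nat.cast_add, Nat.cast_one, add_tsub_cancel_right]
    ring
  · refine (h.norm_term_sub_le n (hsub hy) (hsub hxI) (hv y hy) (hv x hxI)).trans ?_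
    rw [mul_assoc, add_mul]
    gcongr
    exact hK y hy x hxI

end GrowthBound

theorem MemX.exists_growthBound {a : CoeffSeq} (ha : MemX a) : ∃ M, GrowthBound a M := by
  obtain ⟨M, h1, h2, h3, h4⟩ := ha.exists_firstIntegral_bounds
  exact ⟨M, h1, h2, h3, h4⟩

/-! ### Centers and the vanishing of the coefficients of the first integral -/

theorem firstIntegralSeries_at_zero {a : CoeffSeq} (ha : IntegrableSeq a) (y : ℂ) :
    firstIntegralSeries a 0 y = y := by
  rw [firstIntegralSeries, tsum_eq_single 0]
  · simp [firstIntegral_zero]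
  · intro n hn
    obtain ⟨m, rfl⟩ := Nat.exists_eq_succ_of_ne_zero hn
    simp [firstIntegral_at_zero ha]

theorem ae_Icc_of_ae_Ioo {p : ℝ → Prop} {T : ℝ} (h : ∀ᵐ x : ℝ, x ∈ Ioo 0 T → p x) :
    ∀ᵐ x : ℝ, x ∈ Icc 0 T → p x := by
  have h₁ : ∀ᵐ x : ℝ, x ≠ 0 := by simp [ae_iff, measure_singleton]
  have h₂ : ∀ᵐ x : ℝ, x ≠ T := by simp [ae_iff, measure_singleton]
  filter_upwards [h, h₁, h₂] with x hx hx1 hx2 hxI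
  exact hx ⟨lt_of_le_of_ne hxI.1 hx1.symm, lt_of_le_of_ne hxI.2 hx2⟩

/-- `H(x, v x)` has derivative zero almost everywhere; being Lipschitz, hence absolutely continuous,
it is constant. An intermediate time `T` is allowed because the bound on `v` is first known only up
to an exit time. -/
theorem GrowthBound.series_eq_initial {a : CoeffSeq} {M ρ : ℝ} (ha : IntegrableSeq a)
    (h : GrowthBound a M) (hρ : M * ρ ≤ 1 / 3) {v : ℝ → ℂ} (hv : IsSolution a v) {T : ℝ}
    (hT : T ∈ Icc 0 (2 * π)) (hvρ : ∀ x ∈ Icc 0 T, ‖v x‖ ≤ ρ) :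
    firstIntegralSeries a T (v T) = v 0 := by
  obtain ⟨⟨K, hK⟩, hsol⟩ := hv
  have hsub : Icc 0 T ⊆ Icc 0 (2 * π) := Icc_subset_Icc_right hT.2
  have hρ0 : 0 ≤ ρ := (norm_nonneg _).trans (hvρ 0 ⟨le_rfl, hT.1⟩)
  have hK' : ∀ y ∈ Icc 0 T, ∀ z ∈ Icc 0 T, ‖v y - v z‖ ≤ (K : ℝ) * |y - z| := fun y hy z hz => by
    simpa [dist_eq_norm] using hK.dist_le_mul y (hsub hy) z (hsub hz)
  have hlip : LipschitzOnWith (3 / 2 * (ρ + K)).toNNReal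
      (fun y => firstIntegralSeries a y (v y)) (uIcc 0 T) := by
    rw [uIcc_of_le hT.1]
    refine LipschitzOnWith.of_dist_le' fun y hy z hz => ?_
    rw [dist_eq_norm, dist_eq_norm, Real.norm_eq_abs]
    refine (h.norm_series_sub_le hρ (hsub hy) (hsub hz) (hvρ y hy) (hvρ z hz)).trans ?_
    have := hK' y hy z hz
    linarith
  obtain ⟨C, hC⟩ := hlip.absolutelyContinuousOnInterval.const_of_ae_hasDerivAt_zero (by
    rw [uIcc_of_le hT.1]
    refine ae_Icc_of_ae_Ioo ?_
    filter_upwards [h.coeff, ha.ae_hasDerivAt_firstIntegral,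
      (ae_restrict_iff' measurableSet_Icc).1 hsol] with x h1 h2 h3 hx
    have hx' : x ∈ Ioo 0 (2 * π) := Ioo_subset_Ioo_right hT.2 hx
    obtain ⟨D, hD, hvD⟩ := h3 (Ioo_subset_Icc_self hx')
    have := h.hasDerivAt_series_comp hρ hT.2 hx (h1 (Ioo_subset_Ioc_self hx')) (h2 hx') hvρ hK' hvD
    rwa [hD.tsum_eq, sub_self, mul_zero] at this)
  rw [hC T right_mem_uIcc, ← hC 0 left_mem_uIcc, firstIntegralSeries_at_zero ha]

/-- Solutions with small initial values stay small. -/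
theorem GrowthBound.norm_solution_le {a : CoeffSeq} {M ρ : ℝ} (ha : IntegrableSeq a)
    (h : GrowthBound a M) (hρ : M * ρ ≤ 1 / 3) {v : ℝ → ℂ} (hv : IsSolution a v)
    (h0 : ‖v 0‖ < ρ / 2) {x : ℝ} (hx : x ∈ Icc 0 (2 * π)) : ‖v x‖ ≤ ρ := by
  by_contra! hlt
  obtain ⟨K, hK⟩ := hv.1
  have hcont : ContinuousOn (fun x => ‖v x‖) (Icc 0 (2 * π)) := hK.continuousOn.norm
  have hcomp : IsCompact (Icc 0 (2 * π) ∩ (fun x => ‖v x‖) ⁻¹' Ici ρ) :=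
    isCompact_Icc.of_isClosed_subset (hcont.preimage_isClosed_of_isClosed isClosed_Icc isClosed_Ici)
      inter_subset_left
  -- `T` is the first time at which the norm reaches `ρ`.
  obtain ⟨T, ⟨hT, hTρ⟩, hleast⟩ := hcomp.exists_isLeast ⟨x, hx, hlt.le⟩
  have hlow : ∀ y ∈ Icc 0 T, y ≠ T → ‖v y‖ < ρ := fun y hy hne => by
    by_contra! hge
    exact hne (le_antisymm hy.2 (hleast ⟨⟨hy.1, hy.2.trans hT.2⟩, hge⟩))
  have hTpos : 0 < T := by
    refine lt_of_le_of_ne hT.1 fun h00 => ?_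
    have : ρ ≤ ‖v 0‖ := by rw [h00]; exact hTρ
    linarith [norm_nonneg (v 0)]
  have hTle : ‖v T‖ ≤ ρ := by
    have hc : ContinuousOn (fun x => ‖v x‖) (Icc 0 T) := hcont.mono (Icc_subset_Icc_right hT.2)
    have hcl : T ∈ closure (Ico 0 T) := by
      rw [closure_Ico hTpos.ne]
      exact right_mem_Icc.2 hTpos.le
    exact le_on_closure (fun y hy => (hlow y ⟨hy.1, hy.2.le⟩ hy.2.ne).le)
      (hc.mono (closure_Ico hTpos.ne).le) continuousOn_const hcl
  have hall : ∀ y ∈ Icc 0 T, ‖v y‖ ≤ ρ := fun y hy => by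
    rcases eq_or_ne y T with rfl | hne
    · exact hTle
    · exact (hlow y hy hne).le
  -- Since `H(T, v T) = v 0`, this gives `‖v T‖ ≤ 2 * ‖v 0‖ < ρ`, contradicting the choice of `T`.
  have h1 := h.norm_series_sub_self_le hρ hT hTle
  rw [h.series_eq_initial ha hρ hv hT hall, norm_sub_rev] at h1
  have h2 := norm_sub_norm_le (v T) (v 0)
  have h3 : ρ ≤ ‖v T‖ := hTρ
  linarith

theorem eq_zero_of_tsum_pow_eq_zero {c : ℕ → ℂ} {ε B : ℝ} (hε : 0 < ε) (hB : 0 < B)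
    (hc : ∀ n, ‖c n‖ ≤ B ^ n) (h : ∀ r : ℂ, ‖r‖ < ε → ∑' n, c n * r ^ n = 0) (n : ℕ) : c n = 0 := by
  set p := FormalMultilinearSeries.ofScalars ℂ c with hp
  have hrad : ((B⁻¹).toNNReal : ENNReal) ≤ p.radius := by
    refine p.le_radius_of_bound 1 fun n => ?_
    rw [hp, FormalMultilinearSeries.ofScalars_norm, Real.coe_toNNReal _ (by positivity), inv_pow,
      ← div_eq_mul_inv]
    exact div_le_one_of_le₀ (hc n) (by positivity)
  have hpos : 0 < p.radius := lt_of_lt_of_le (by simpa using hB) hrad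
  have hzero : p = 0 := by
    refine (p.hasFPowerSeriesOnBall hpos).hasFPowerSeriesAt.eq_zero_of_eventually ?_
    filter_upwards [Metric.ball_mem_nhds (0 : ℂ) hε] with r hr
    have := h r (by simpa using hr)
    simpa [hp, FormalMultilinearSeries.sum, FormalMultilinearSeries.ofScalars_apply_eq,
      mul_comm] using this
  exact congrFun ((FormalMultilinearSeries.ofScalars_series_eq_zero (E := ℂ)).1 hzero) n

theorem IsCenter.firstIntegral_eq_zero {a : CoeffSeq} (ha : MemX a) (hc : IsCenter a) (n : ℕ) :
    firstIntegral a (n + 1) (2 * π) = 0 := by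
  obtain ⟨M, h⟩ := ha.exists_growthBound
  obtain ⟨ε, hε, hc⟩ := hc
  have hM := h.pos
  set ρ : ℝ := 1 / (3 * M) with hρdef
  have hρ0 : 0 < ρ := by positivity
  have hρ : M * ρ ≤ 1 / 3 := by rw [hρdef]; field_simp; rfl
  have key : ∀ r : ℂ, ‖r‖ < min ε (ρ / 2) → firstIntegralSeries a (2 * π) r = r := by
    intro r hr
    obtain ⟨v, hv, hv0, hv1⟩ := hc r (hr.trans_le (min_le_left _ _))
    have := h.series_eq_initial ha.integrableSeq hρ hv two_pi_mem_Icc fun x hx =>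
      h.norm_solution_le ha.integrableSeq hρ hv (by rw [hv0]; exact hr.trans_le (min_le_right _ _))
        hx
    rwa [hv1, hv0] at this
  have hc0 := eq_zero_of_tsum_pow_eq_zero
    -- These are the coefficients of `(H(2π, r) - r) / r`: the term `h₀ = 1` is removed.
    (c := fun n => if n = 0 then 0 else firstIntegral a n (2 * π))
    (lt_min hε (half_pos hρ0)) hM (fun n => ?_) (fun r hr => ?_) (n + 1)
  · simpa using hc0
  · split_ifs
    · simpa using pow_nonneg hM.le n
    · exact h.norm_le n two_pi_mem_Icc
  · rcases eq_or_ne r 0 with rfl | hr0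
    · rw [tsum_eq_single 0 fun n hn => by simp [hn]]
      simp
    · have hs := h.summable_term hρ two_pi_mem_Icc (y := r)
        (by linarith [hr.trans_le (min_le_right _ _)])
      have hkey := key r hr
      rw [firstIntegralSeries, hs.tsum_eq_zero_add] at hkey
      simp only [firstIntegral_zero, zero_add, pow_one, one_mul, add_eq_left] at hkey
      refine (mul_eq_zero.1 (?_ : r * _ = 0)).resolve_left hr0
      rw [← tsum_mul_left]
      have hs' : Summable fun n => r * ((if n = 0 then 0 else firstIntegral a n (2 * π)) * r ^ n) :=
        (summable_nat_add_iff 1).1 (((summable_nat_add_iff 1).2 hs).congr fun n => by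
          simp only [Nat.add_eq_zero_iff, one_ne_zero, and_false, if_false]
          ring)
      rw [hs'.tsum_eq_zero_add]
      refine Eq.trans ?_ hkey
      simp only [if_true, zero_mul, mul_zero, zero_add, Nat.add_eq_zero_iff, one_ne_zero, and_false,
        if_false]
      exact tsum_congr fun n => by ring

/-- The solution with initial value `r`, obtained by inverting the first integral. -/
theorem GrowthBound.exists_inverse {a : CoeffSeq} {M ρ : ℝ} (h : GrowthBound a M)
    (hρ : M * ρ ≤ 1 / 3) {r : ℂ} (hr : ‖r‖ ≤ ρ / 2) {x : ℝ} (hx : x ∈ Icc 0 (2 * π)) :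
    ∃ y, ‖y‖ ≤ ρ ∧ firstIntegralSeries a x y = r := by
  have hρ0 : 0 ≤ ρ := by linarith [norm_nonneg r]
  -- Fixed points of `f` solve `H(x, y) = r`, and `f` is a contraction with constant `1/2`.
  let f : ℂ → ℂ := fun y => r - (firstIntegralSeries a x y - y)
  have hmaps : MapsTo f (Metric.closedBall 0 ρ) (Metric.closedBall 0 ρ) := fun y hy => by
    rw [mem_closedBall_zero_iff] at hy ⊢
    have := h.norm_series_sub_self_le hρ hx hy
    exact (norm_sub_le _ _).trans (by linarith)
  have hcontr : ContractingWith (1 / 2) (hmaps.restrict f _ _) := by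
    refine ⟨by norm_num, LipschitzWith.of_dist_le_mul fun y z => ?_⟩
    have := h.norm_series_sub_sub_le hρ hx (mem_closedBall_zero_iff.1 z.2)
      (mem_closedBall_zero_iff.1 y.2)
    rw [Subtype.dist_eq, Subtype.dist_eq, dist_eq_norm, dist_eq_norm, norm_sub_rev y.1]
    simpa [f] using this
  obtain ⟨y, hy, hfix, -⟩ := hcontr.exists_fixedPoint' Metric.isClosed_closedBall.isComplete hmaps
    (Metric.mem_closedBall_self hρ0) (edist_ne_top _ _)
  refine ⟨y, mem_closedBall_zero_iff.1 hy, ?_⟩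
  have h2 : r - (firstIntegralSeries a x y - y) = y := hfix
  linear_combination -h2

/-- The solution is defined implicitly by `H(x, v x) = r`. Differentiating and dividing by `H_y`
gives the equation, while `H(2π, y) = y` closes the orbit. -/
theorem isCenter_of_firstIntegral_eq_zero {a : CoeffSeq} (ha : MemX a)
    (h0 : ∀ n, firstIntegral a (n + 1) (2 * π) = 0) : IsCenter a := by
  obtain ⟨M, h⟩ := ha.exists_growthBound
  have hM := h.pos
  set ρ : ℝ := 1 / (3 * M) with hρdef
  have hρ0 : 0 < ρ := by positivity
  have hρ : M * ρ ≤ 1 / 3 := by rw [hρdef]; field_simp; rfl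
  refine ⟨ρ / 2, by positivity, fun r hr => ?_⟩
  choose! v hvρ hvr using fun x (hx : x ∈ Icc 0 (2 * π)) => h.exists_inverse hρ hr.le hx
  -- The constant is 2, from inverting `H` in `y`, times `3/2 * ρ`, its Lipschitz constant in `x`.
  have hLip : ∀ y ∈ Icc 0 (2 * π), ∀ z ∈ Icc 0 (2 * π),
      ‖v y - v z‖ ≤ 3 * ρ * |y - z| := fun y hy z hz => by
    have h1 := h.norm_sub_le_series hρ hy (hvρ y hy) (hvρ z hz)
    have h2 := h.norm_series_sub_le hρ hz hy (hvρ z hz) (hvρ z hz)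
    rw [hvr y hy, ← hvr z hz] at h1
    rw [sub_self, norm_zero, add_zero, abs_sub_comm] at h2
    linarith
  have hLip' : LipschitzOnWith (3 * ρ).toNNReal v (Icc 0 (2 * π)) :=
    LipschitzOnWith.of_dist_le' fun y hy z hz => by
      rw [dist_eq_norm, dist_eq_norm]
      exact hLip y hy z hz
  have hv0 : v 0 = r := by
    rw [← hvr 0 zero_mem_Icc_two_pi, firstIntegralSeries_at_zero ha.integrableSeq]
  refine ⟨v, ⟨⟨_, hLip'⟩, ?_⟩, hv0, ?_⟩
  · rw [ae_restrict_iff' measurableSet_Icc]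
    refine ae_Icc_of_ae_Ioo ?_
    filter_upwards [h.coeff, ha.integrableSeq.ae_hasDerivAt_firstIntegral,
      hLip'.ae_differentiableWithinAt_of_mem_real] with x h1 h2 h3 hx
    have hxI := Ioo_subset_Icc_self hx
    have hax := h1 (Ioo_subset_Ioc_self hx)
    have hnhds := Icc_mem_nhds hx.1 hx.2
    have hD := ((h3 hxI).differentiableAt hnhds).hasDerivAt
    have hder := h.hasDerivAt_series_comp hρ le_rfl hx hax (h2 hx) hvρ hLip hD
    have hconst : HasDerivAt (fun y => firstIntegralSeries a y (v y)) 0 x :=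
      (hasDerivAt_const x r).congr_of_eventuallyEq
        (Filter.mem_of_superset hnhds fun y hy => hvr y hy)
    have hzero := (mul_eq_zero.1 (hder.unique hconst)).resolve_left
      (h.derivSeries_ne_zero hρ hxI (hvρ x hxI))
    refine ⟨_, ?_, hD⟩
    rw [sub_eq_zero.1 hzero]
    refine (Summable.of_norm_bounded ?_
      (GrowthBound.norm_coeff_mul_pow_le hM.le hax (hvρ x hxI))).hasSum
    exact (summable_geometric_of_lt_one (by positivity) (by linarith)).mul_right _
  · rw [hv0, ← hvr (2 * π) two_pi_mem_Icc, firstIntegralSeries, tsum_eq_single 0]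
    · simp [firstIntegral_zero]
    · intro n hn
      obtain ⟨m, rfl⟩ := Nat.exists_eq_succ_of_ne_zero hn
      simp [h0]

/-! ### Polynomial dependence on the parameter -/

/-- The functions `ℝ → ℂ` given by polynomials with coefficients in `F'`. -/
noncomputable def polyFun (F' : Subfield ℂ) : Subalgebra F' (ℝ → ℂ) :=
  (Polynomial.aeval (R := F') (fun t : ℝ => (t : ℂ))).range

variable {F' : Subfield ℂ}

theorem ofReal_mem_polyFun : (fun t : ℝ => (t : ℂ)) ∈ polyFun F' :=
  ⟨Polynomial.X, Polynomial.aeval_X _⟩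

theorem const_mem_polyFun {z : ℂ} (hz : z ∈ F') : (fun _ : ℝ => z) ∈ polyFun F' :=
  (polyFun F').algebraMap_mem ⟨z, hz⟩

theorem isAlgebraic_of_mem_polyFun {f : ℝ → ℂ} (hf : f ∈ polyFun F') {s ξ : ℝ} (hs : f s ≠ 0)
    (hξ : f ξ = 0) : IsAlgebraic F' (ξ : ℂ) := by
  obtain ⟨p, rfl⟩ := hf
  have heval : ∀ t : ℝ, Polynomial.aeval (R := F') (fun t : ℝ => (t : ℂ)) p t =
      Polynomial.aeval (t : ℂ) p := fun t =>
    (Polynomial.aeval_algHom_apply (Pi.evalAlgHom F' (fun _ : ℝ => ℂ) t) _ p).symm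
  refine ⟨p, fun hp => hs ?_, (heval ξ).symm.trans hξ⟩
  simp [hp]

theorem concatProd_mem_polyFun {J K : ℝ → List ℕ → ℂ} (hJ : ∀ u, (fun t => J t u) ∈ polyFun F')
    (hK : ∀ v, (fun t => K t v) ∈ polyFun F') (w : List ℕ) :
    (fun t => concatProd (J t) (K t) w) ∈ polyFun F' := by
  induction w generalizing J with
  | nil => exact mul_mem (hJ []) (hK [])
  | cons i w ih =>
    exact add_mem (mul_mem (hJ []) (hK (i :: w))) (ih fun u => hJ (i :: u))

theorem concatProd_sub_mem_polyFun {J K : ℝ → List ℕ → ℂ} (w : List ℕ)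
    (hJ : ∀ u, u.length < w.length → (fun t => J t u) ∈ polyFun F')
    (hK : ∀ v, (fun t => K t v) ∈ polyFun F') (hK1 : ∀ t, K t [] = 1) :
    (fun t => concatProd (J t) (K t) w - J t w) ∈ polyFun F' := by
  induction w generalizing J with
  | nil =>
    simp only [concatProd, hK1, mul_one, sub_self]
    exact zero_mem _
  | cons i w ih =>
    simp only [concatProd, add_sub_assoc]
    exact add_mem (mul_mem (hJ [] (by simp)) (hK (i :: w)))
      (ih (J := fun t u => J t (i :: u)) fun u hu => hJ (i :: u) (by simpa using hu))

/-- Solves a triangular system by induction on length, the right-handed analogue of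
`concatProd_left_cancel`. It yields the integrals of an inverse path. -/
theorem mem_polyFun_of_concatProd {J K : ℝ → List ℕ → ℂ}
    (hJK : ∀ w, (fun t => concatProd (J t) (K t) w) ∈ polyFun F')
    (hK : ∀ v, (fun t => K t v) ∈ polyFun F') (hK1 : ∀ t, K t [] = 1) (w : List ℕ) :
    (fun t => J t w) ∈ polyFun F' := by
  induction hn : w.length using Nat.strong_induction_on generalizing w with
  | _ n ih =>
    have := sub_mem (hJK w) (concatProd_sub_mem_polyFun (J := J) w
      (fun u hu => ih u.length (hn ▸ hu) u rfl) hK hK1)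
    simpa [Pi.sub_def] using this

theorem returnCoeff_mem_polyFun (n : ℕ) {J : ℝ → List ℕ → ℂ}
    (hJ : ∀ u, (fun t => J t u) ∈ polyFun F') :
    (fun t => returnCoeff n (J t)) ∈ polyFun F' := by
  induction n using Nat.strong_induction_on generalizing J with
  | _ n ih =>
    cases n with
    | zero => simpa only [returnCoeff_zero] using hJ []
    | succ n =>
      have := neg_mem (sum_mem (t := Finset.range (n + 1)) fun m hm =>
        mul_mem (const_mem_polyFun (F' := F') (z := (m : ℂ) + 1) (by simp [add_mem, natCast_mem]))
          (ih m (Finset.mem_range.1 hm) (J := fun t u => J t ((n - m) :: u)) fun u => hJ _))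
      simp only [returnCoeff_succ]
      convert! this using 1
      funext t
      simp

/-! ### Iterated integrals of polynomial families -/

section

variable (F') (β : CoeffSeq)

/-- Finite sums of `z t ^ j βᵢ(s)` with `z` in `F'`. -/
noncomputable def coeffSpan : Submodule F' (ℝ → ℝ → ℂ) :=
  Submodule.span F' (range fun p : ℕ × ℕ => fun t s : ℝ => (t : ℂ) ^ p.1 * β p.2 (s : Circ))

/-- Finite sums of iterated integrals of `β` multiplied by `z t ^ j` with `z` in `F'`. -/
noncomputable def nestedSpan : Submodule F' (ℝ → ℝ → ℂ) :=
  Submodule.span F' (range fun p : ℕ × List ℕ =>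
    fun t s : ℝ => (t : ℂ) ^ p.1 * nestedIntegral β p.2 s)

variable {F' β}

/-- By bilinearity it suffices to treat generators, where integration prepends a letter to the word
and adds the powers of `t`. -/
theorem integral_mul_mem_nestedSpan (hβ : IntegrableSeq β) {c g : ℝ → ℝ → ℂ}
    (hc : c ∈ coeffSpan F' β) (hg : g ∈ nestedSpan F' β) :
    (∀ t, IntervalIntegrable (fun s => c t s * g t s) volume 0 (2 * π)) ∧
      ∃ g' ∈ nestedSpan F' β, ∀ t, ∀ x ∈ Icc 0 (2 * π),
        ∫ s in (0 : ℝ)..x, c t s * g t s = g' t x := by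
  have hmono : ∀ {f : ℝ → ℂ} {x : ℝ}, x ∈ Icc 0 (2 * π) →
      IntervalIntegrable f volume 0 (2 * π) → IntervalIntegrable f volume 0 x :=
    fun hx hf => hf.mono_set (uIcc_subset_of_mem zero_mem_Icc_two_pi hx)
  induction hc, hg using Submodule.span_induction₂ with
  | mem_mem c g hc hg =>
    obtain ⟨⟨j, i⟩, rfl⟩ := hc
    obtain ⟨⟨k, w⟩, rfl⟩ := hg
    have heq : ∀ t s : ℝ, ((t : ℂ) ^ j * β i (s : Circ)) * ((t : ℂ) ^ k * nestedIntegral β w s) =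
        (t : ℂ) ^ (j + k) * (β i (s : Circ) * nestedIntegral β w s) := fun t s => by ring
    simp only [heq]
    refine ⟨fun t => (hβ.mul_nestedIntegral i w).const_mul _, _,
      Submodule.subset_span ⟨(j + k, i :: w), rfl⟩, fun t x _ => ?_⟩
    rw [intervalIntegral.integral_const_mul]
    rfl
  | zero_left g hg => exact ⟨fun t => by simp, 0, zero_mem _, fun t x _ => by simp⟩
  | zero_right c hc => exact ⟨fun t => by simp, 0, zero_mem _, fun t x _ => by simp⟩
  | add_left c c' g hc hc' hg h h' =>
    obtain ⟨hi, G, hG, hI⟩ := h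
    obtain ⟨hi', G', hG', hI'⟩ := h'
    simp only [Pi.add_apply, add_mul]
    refine ⟨fun t => (hi t).add (hi' t), _, add_mem hG hG', fun t x hx => ?_⟩
    rw [intervalIntegral.integral_add (hmono hx (hi t)) (hmono hx (hi' t)), hI t x hx, hI' t x hx]
    rfl
  | add_right c g g' hc hg hg' h h' =>
    obtain ⟨hi, G, hG, hI⟩ := h
    obtain ⟨hi', G', hG', hI'⟩ := h'
    simp only [Pi.add_apply, mul_add]
    refine ⟨fun t => (hi t).add (hi' t), _, add_mem hG hG', fun t x hx => ?_⟩
    rw [intervalIntegral.integral_add (hmono hx (hi t)) (hmono hx (hi' t)), hI t x hx, hI' t x hx]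
    rfl
  | smul_left z c g hc hg h =>
    obtain ⟨hi, G, hG, hI⟩ := h
    have heq : ∀ t s : ℝ, (z • c) t s * g t s = (z : ℂ) * (c t s * g t s) := fun t s => by
      rw [← mul_assoc]; rfl
    simp only [heq]
    refine ⟨fun t => (hi t).const_mul _, z • G, Submodule.smul_mem _ _ hG, fun t x hx => ?_⟩
    rw [intervalIntegral.integral_const_mul, hI t x hx]
    rfl
  | smul_right z c g hc hg h =>
    obtain ⟨hi, G, hG, hI⟩ := h
    have heq : ∀ t s : ℝ, c t s * (z • g) t s = (z : ℂ) * (c t s * g t s) := fun t s => by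
      rw [mul_left_comm]; rfl
    simp only [heq]
    refine ⟨fun t => (hi t).const_mul _, z • G, Submodule.smul_mem _ _ hG, fun t x hx => ?_⟩
    rw [intervalIntegral.integral_const_mul, hI t x hx]
    rfl

theorem one_mem_nestedSpan : (fun _ _ => 1) ∈ nestedSpan F' β := by
  refine Submodule.subset_span ⟨(0, []), ?_⟩
  funext t s
  simp [nestedIntegral]

theorem exists_mem_nestedSpan (hβ : IntegrableSeq β) {c : ℝ → CoeffSeq}
    (hc : ∀ k, (fun t s : ℝ => c t k (s : Circ)) ∈ coeffSpan F' β) (w : List ℕ) :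
    ∃ g ∈ nestedSpan F' β, ∀ t, ∀ x ∈ Icc 0 (2 * π), nestedIntegral (c t) w x = g t x := by
  induction w with
  | nil => exact ⟨_, one_mem_nestedSpan, fun t x _ => rfl⟩
  | cons i w ih =>
    obtain ⟨g, hg, hgeq⟩ := ih
    obtain ⟨-, g', hg', heq⟩ := integral_mul_mem_nestedSpan hβ (hc i) hg
    refine ⟨g', hg', fun t x hx => (intervalIntegral.integral_congr fun s hs => ?_).trans
      (heq t x hx)⟩
    rw [uIcc_of_le hx.1] at hs
    simp only [hgeq t s ⟨hs.1, hs.2.trans hx.2⟩]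

/-- This is where the field of definition of the class enters. -/
theorem eval_nestedSpan_mem_polyFun (hβ : ∀ w, iteratedIntegral w β ∈ F') {g : ℝ → ℝ → ℂ}
    (hg : g ∈ nestedSpan F' β) : (fun t => g t (2 * π)) ∈ polyFun F' := by
  induction hg using Submodule.span_induction with
  | mem g hg =>
    obtain ⟨⟨j, w⟩, rfl⟩ := hg
    exact mul_mem (pow_mem ofReal_mem_polyFun j) (const_mem_polyFun (hβ w))
  | zero => exact zero_mem _
  | add g g' _ _ h h' => exact add_mem h h'
  | smul z g _ h => exact (polyFun F').smul_mem h z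

end

theorem IsPolynomialSeq.mem_coeffSpan {b : ℕ → Circ → ℂ} {e : ℕ → {m : ℕ →₀ ℕ // m ≠ 0}}
    (he : Function.Surjective e) {c : ℝ → CoeffSeq} (hc : IsPolynomialSeq F' b c) (k : ℕ) :
    (fun t s : ℝ => c t k (s : Circ)) ∈ coeffSpan F' fun i => monomial b (e i) := by
  obtain ⟨d, f, hf, hcf⟩ := hc k
  have key : ∀ j, ∀ f ∈ algebraGen F' b, (fun t s : ℝ => (t : ℂ) ^ j * f (s : Circ)) ∈
      coeffSpan F' fun i => monomial b (e i) := fun j f hf => by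
    induction hf using Submodule.span_induction with
    | mem f hf =>
      obtain ⟨m, rfl⟩ := hf
      obtain ⟨i, rfl⟩ := he m
      exact Submodule.subset_span ⟨(j, i), rfl⟩
    | zero =>
      simp only [Pi.zero_apply, mul_zero]
      exact zero_mem _
    | add f f' _ _ h h' =>
      simp only [Pi.add_apply, mul_add]
      exact add_mem h h'
    | smul z f _ h =>
      convert! Submodule.smul_mem _ z h using 1
      funext t s
      exact mul_left_comm _ _ _
  convert! sum_mem (t := Finset.range (d + 1)) fun j _ => key j (f j) (hf j) using 1
  funext t s
  simp [hcf]

theorem IsPolynomialSeq.integrableSeq_and_mem_polyFun {b : ℕ → Circ → ℂ}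
    {e : ℕ → {m : ℕ →₀ ℕ // m ≠ 0}} (he : Function.Surjective e)
    (hβ : IntegrableSeq fun i => monomial b (e i))
    (hF : ∀ w, iteratedIntegral w (fun i => monomial b (e i)) ∈ F') {c : ℝ → CoeffSeq}
    (hc : IsPolynomialSeq F' b c) :
    (∀ t, IntegrableSeq (c t)) ∧ ∀ w, (fun t => iteratedIntegral w (c t)) ∈ polyFun F' := by
  have hmem := hc.mem_coeffSpan he
  refine ⟨fun t i => ?_, fun w => ?_⟩
  · simpa using (integral_mul_mem_nestedSpan hβ (hmem i) one_mem_nestedSpan).1 t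
  · obtain ⟨g, hg, heq⟩ := exists_mem_nestedSpan hβ hmem w
    convert! eval_nestedSpan_mem_polyFun hF hg using 1
    funext t
    exact heq t _ two_pi_mem_Icc

theorem IsStarProduct.integrableSeq_and_mem_polyFun {b : ℕ → Circ → ℂ}
    {e : ℕ → {m : ℕ →₀ ℕ // m ≠ 0}} (he : Function.Surjective e)
    (hβ : IntegrableSeq fun i => monomial b (e i))
    (hF : ∀ w, iteratedIntegral w (fun i => monomial b (e i)) ∈ F') {Q : ℝ → CoeffSeq}
    (hQ : IsStarProduct F' b Q) :
    (∀ t, IntegrableSeq (Q t)) ∧ ∀ w, (fun t => iteratedIntegral w (Q t)) ∈ polyFun F' := by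
  induction hQ with
  | pos c hc => exact hc.integrableSeq_and_mem_polyFun he hβ hF
  | neg c hc =>
    obtain ⟨hint, hpoly⟩ := hc.integrableSeq_and_mem_polyFun he hβ hF
    refine ⟨fun t => (hint t).inv, mem_polyFun_of_concatProd
      (J := fun t u => iteratedIntegral u (inv (c t))) (K := fun t v => iteratedIntegral v (c t))
      (fun w => ?_) hpoly fun t => rfl⟩
    simp only [concatProd_iteratedIntegral_inv (hint _)]
    split_ifs
    · exact one_mem _
    · exact zero_mem _
  | mul P Q _ _ hP hQ =>
    refine ⟨fun t => (hP.1 t).starProd (hQ.1 t), fun w => ?_⟩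
    simp only [iteratedIntegral_starProd (hP.1 _) (hQ.1 _)]
    exact concatProd_mem_polyFun (J := fun t u => iteratedIntegral u (Q t))
      (K := fun t v => iteratedIntegral v (P t)) hQ.2 hP.2 w

end CenterProblem

/-! ### The main theorem -/

theorem theorem3p15 (F F' : Subfield ℂ) (hFF' : F ≤ F')
    (b : ℕ → CenterProblem.Circ → ℂ)
    (hm : ∀ k, MeasureTheory.AEStronglyMeasurable (b k) MeasureTheory.volume)
    (hb : ∀ k, ∀ᵐ x ∂(MeasureTheory.volume : MeasureTheory.Measure CenterProblem.Circ),
      ‖b k x‖ ≤ 1)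
    (e : ℕ → {m : ℕ →₀ ℕ // m ≠ 0}) (he : Function.Surjective e)
    (hF : CenterProblem.ClassDefinedOver F (CenterProblem.hatb b hm hb e))
    (P : Set.Icc (0 : ℝ) 1 → CenterProblem.X)
    (hP : CenterProblem.IsPolynomialMap F' b P)
    (h0 : CenterProblem.arc P ⟨0, by norm_num⟩ ∉ CenterProblem.centerSubgroup)
    (ξ : Set.Icc (0 : ℝ) 1) (hξ0 : 0 < (ξ : ℝ))
    (hξ : CenterProblem.arc P ξ ∈ CenterProblem.centerSubgroup) :
    IsAlgebraic F' ((ξ : ℝ) : ℂ) := by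
  obtain ⟨Q, hQ, hPQ⟩ := hP
  have hpoly := (hQ.integrableSeq_and_mem_polyFun he
    (CenterProblem.memX_monomial b hm hb e).integrableSeq fun w => hFF' (hF w)).2
  have hne : ∃ n, CenterProblem.firstIntegral (P ⟨0, by norm_num⟩).1 (n + 1) (2 * π) ≠ 0 := by
    by_contra! hall
    exact h0 ⟨_, CenterProblem.isCenter_of_firstIntegral_eq_zero (P ⟨0, by norm_num⟩).2 hall, rfl⟩
  obtain ⟨n, hn⟩ := hne
  -- The center `a` need only be equivalent to `P ξ`; the two share all iterated integrals, hence
  -- all `hₙ(2π)`.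
  obtain ⟨a, ha, haξ⟩ := hξ
  have hzero := CenterProblem.IsCenter.firstIntegral_eq_zero a.2 ha n
  have hQP : ∀ t : Set.Icc (0 : ℝ) 1, CenterProblem.returnCoeff (n + 1)
      (fun w => CenterProblem.iteratedIntegral w (Q t)) =
      CenterProblem.firstIntegral (P t).1 (n + 1) (2 * π) := fun t =>
    congrArg _ (funext fun w => (CenterProblem.iteratedIntegral_congr (hPQ t) w).symm)
  refine CenterProblem.isAlgebraic_of_mem_polyFun (s := 0)
    (CenterProblem.returnCoeff_mem_polyFun (n + 1)
      (J := fun t w => CenterProblem.iteratedIntegral w (Q t)) hpoly) ?_ ?_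
  · exact (hQP ⟨0, by norm_num⟩).trans_ne hn
  · refine (hQP ξ).trans (Eq.trans ?_ hzero)
    exact congrArg _ (funext fun w => (CenterProblem.iteratedIntegral_eq_of_cls_eq haξ w).symm)
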